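/- Let $M$ be a smooth manifold of dimension $2m_0+1$ ($m_0\ge 0$) with a pseudo-Hermitian structure $(HM,J,\theta)$: that is, $T_{1,0}M\subset TM\otimes\mathbb C$ is a smooth complex subbundle of complex rank $m_0$ with $T_{1,0}M\cap T_{0,1}M=\{0\}$, where $T_{0,1}M=\overline{T_{1,0}M}$, and $[\Gamma(T_{1,0}M),\Gamma(T_{1,0}M)]\subseteq\Gamma(T_{1,0}M)$; $HM=\mathrm{Re}\,(T_{1,0}M\oplus T_{0,1}M)$ carries the complex structure $J(Z+\bar Z)=i(Z-\bar Z)$ for $Z\in T_{1,0}M$; and $\theta$ is a smooth real $1$-form with $HM=\ker\theta$ whose Levi form $L_\theta(X,Y)=d\theta(X,JY)$ is positive definite on $HM$. Here $2\,d\theta(X,Y)=X\theta(Y)-Y\theta(X)-\theta([X,Y])$. Let $\xi$ be the Reeb vector field ($\theta(\xi)=1$, $d\theta(\xi,\cdot)=0$), let $\pi_H:TM\to HM$, $\pi_HX=X-\theta(X)\xi$, be the projection, and let $g_\theta(X,Y)=L_\theta(\pi_HX,\pi_HY)+\theta(X)\theta(Y)$ be the Webster metric. Extend $\pi_H$ complex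 linearly, and $g_\theta$ and the Lie bracket complex bilinearly. For a complex tangent vector or vector field $Z$ write $Z_H=\pi_HZ$, and $Z_{1,0}$ for its component in $T_{1,0}M$ in the decomposition $TM\otimes\mathbb C=T_{1,0}M\oplus T_{0,1}M\oplus\mathbb C\xi$. A smooth local $(1,0)$ vector field $u$ around $p\in M$ is called pseudoholomorphic at $p$ if $[u,\bar v]_{1,0}(p)=0$ for every smooth $(1,0)$ vector field $v$ around $p$. It is called quasi holomorphic at $p$ if, in addition, $[[u,\bar v]_H,w]_{1,0}(p)=0$ for all $(1,0)$ vector fields $v,w$ around $p$ that are pseudoholomorphic at $p$. Then for every $p\in M$ there is a smooth local frame $\{e_1,\dots,e_{m_0}\}$ of $T_{1,0}M$ around $p$ such that, with $g_{i\bar j}=g_\theta(e_i,\bar e_j)$: (i) each $e_i$ is quasi holomorphic at $p$; (ii) $g_{i\bar j}(p)=\delta_{ij}$ and $d^Hg_{i\bar j}(p)=0$ for all $i,j$, where $d^Hf=df|_{HM}$ is the horizontal differential; (iii) $[\xi,e_i]_{1,0}(p)=0$ for each $i$. -/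

import Mathlib

open scoped Manifold ContDiff Topology

noncomputable section

namespace PseudoHermitian

/-! ### The complexification of a real vector space -/

/-- The complexification `V ⊗ ℂ` of a real vector space, whose elements `X + iY` are written as
pairs `(X, Y)`. -/
def Cplx (V : Type*) : Type _ := V × V

namespace Cplx

variable {V : Type*} [AddCommGroup V] [Module ℝ V]

instance : AddCommGroup (Cplx V) := inferInstanceAs (AddCommGroup (V × V))

/-- `(a + ib)(X + iY) = (aX - bY) + i(aY + bX)`. -/
instance : SMul ℂ (Cplx V) :=
  ⟨fun c Z => (c.re • Z.1 - c.im • Z.2, c.re • Z.2 + c.im • Z.1)⟩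

theorem smul_def (c : ℂ) (Z : Cplx V) :
    c • Z = ((c.re • Z.1 - c.im • Z.2, c.re • Z.2 + c.im • Z.1) : V × V) := rfl

instance : Module ℂ (Cplx V) where
  one_smul Z := by
    refine Prod.ext ?_ ?_ <;> simp [smul_def]
  mul_smul a b Z := by
    refine Prod.ext ?_ ?_
    · change (a * b).re • Z.1 - (a * b).im • Z.2 =
        a.re • (b.re • Z.1 - b.im • Z.2) - a.im • (b.re • Z.2 + b.im • Z.1)
      simp only [Complex.mul_re, Complex.mul_im]
      module
    · change (a * b).re • Z.2 + (a * b).im • Z.1 =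
        a.re • (b.re • Z.2 + b.im • Z.1) + a.im • (b.re • Z.1 - b.im • Z.2)
      simp only [Complex.mul_re, Complex.mul_im]
      module
  smul_zero a := by
    refine Prod.ext ?_ ?_
    · change a.re • (0 : V) - a.im • (0 : V) = 0
      simp
    · change a.re • (0 : V) + a.im • (0 : V) = 0
      simp
  smul_add a Z W := by
    refine Prod.ext ?_ ?_
    · change a.re • (Z.1 + W.1) - a.im • (Z.2 + W.2) =
        (a.re • Z.1 - a.im • Z.2) + (a.re • W.1 - a.im • W.2)
      module
    · change a.re • (Z.2 + W.2) + a.im • (Z.1 + W.1) =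
        (a.re • Z.2 + a.im • Z.1) + (a.re • W.2 + a.im • W.1)
      module
  add_smul a b Z := by
    refine Prod.ext ?_ ?_
    · change (a + b).re • Z.1 - (a + b).im • Z.2 =
        (a.re • Z.1 - a.im • Z.2) + (b.re • Z.1 - b.im • Z.2)
      simp only [Complex.add_re, Complex.add_im]
      module
    · change (a + b).re • Z.2 + (a + b).im • Z.1 =
        (a.re • Z.2 + a.im • Z.1) + (b.re • Z.2 + b.im • Z.1)
      simp only [Complex.add_re, Complex.add_im]
      module
  zero_smul Z := by
    refine Prod.ext ?_ ?_
    · change (0 : ℂ).re • Z.1 - (0 : ℂ).im • Z.2 = 0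
      simp
    · change (0 : ℂ).re • Z.2 + (0 : ℂ).im • Z.1 = 0
      simp

/-- The element `X + iY`. -/
def mk (X Y : V) : Cplx V := (X, Y)

/-- The real part `X` of `X + iY`. -/
def re : Cplx V →ₗ[ℝ] V where
  toFun Z := Z.1
  map_add' _ _ := rfl
  map_smul' r Z := by
    change (r : ℂ).re • Z.1 - (r : ℂ).im • Z.2 = r • Z.1
    simp

/-- The imaginary part `Y` of `X + iY`. -/
def im : Cplx V →ₗ[ℝ] V where
  toFun Z := Z.2
  map_add' _ _ := rfl
  map_smul' r Z := by
    change (r : ℂ).re • Z.2 + (r : ℂ).im • Z.1 = r • Z.2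
    simp

/-- Complex conjugation `X + iY ↦ X - iY`. -/
def conj (Z : Cplx V) : Cplx V := mk (re Z) (-im Z)

/-- The complex linear extension of a real linear endomorphism. -/
def extend (A : V →ₗ[ℝ] V) (Z : Cplx V) : Cplx V := mk (A (re Z)) (A (im Z))

/-- The complex bilinear extension of a real bilinear form. -/
def extendForm (B : V →ₗ[ℝ] V →ₗ[ℝ] ℝ) (Z W : Cplx V) : ℂ :=
  ⟨B (re Z) (re W) - B (im Z) (im W), B (re Z) (im W) + B (im Z) (re W)⟩

theorem ext {Z W : Cplx V} (h : re Z = re W) (h' : im Z = im W) : Z = W := Prod.ext h h'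

theorem re_I_smul (Z : Cplx V) : re (Complex.I • Z) = -im Z := by
  change Complex.I.re • Z.1 - Complex.I.im • Z.2 = -Z.2
  simp

theorem im_I_smul (Z : Cplx V) : im (Complex.I • Z) = re Z := by
  change Complex.I.re • Z.2 + Complex.I.im • Z.1 = Z.1
  simp

end Cplx

/-! ### Complex vector fields and one-forms on a manifold -/

section Manifold

variable (E : Type*) [NormedAddCommGroup E] [NormedSpace ℝ E]
  (M : Type*) [TopologicalSpace M] [ChartedSpace E M]

/-- Real vector fields on `M` (no regularity). -/
abbrev VField : Type _ := (x : M) → TangentSpace 𝓘(ℝ, E) x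

/-- Complex vector fields on `M` (no regularity): sections of `TM ⊗ ℂ`. -/
abbrev CField : Type _ := (x : M) → Cplx (TangentSpace 𝓘(ℝ, E) x)

variable {E M}

/-- The expression of a one-form in the preferred chart at `x₀`: its pullback to `E` under the
inverse of the chart. -/
def oneFormInChart (θ : (x : M) → TangentSpace 𝓘(ℝ, E) x →L[ℝ] ℝ) (x₀ : M) :
    E → (E →L[ℝ] ℝ) := fun y =>
  (θ ((extChartAt 𝓘(ℝ, E) x₀).symm y)).comp
    (mfderiv 𝓘(ℝ, E) 𝓘(ℝ, E) (extChartAt 𝓘(ℝ, E) x₀).symm y)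

/-- The exterior derivative of a one-form at `x`, computed in the chart at `x`, with the
normalization `2 dθ(X, Y) = X θ(Y) - Y θ(X) - θ([X, Y])`. -/
def dOneForm (θ : (x : M) → TangentSpace 𝓘(ℝ, E) x →L[ℝ] ℝ) (x : M) :
    TangentSpace 𝓘(ℝ, E) x →ₗ[ℝ] TangentSpace 𝓘(ℝ, E) x →ₗ[ℝ] ℝ :=
  let A : E →L[ℝ] E →L[ℝ] ℝ :=
    fderiv ℝ (oneFormInChart θ x) (extChartAt 𝓘(ℝ, E) x x)
  let D : TangentSpace 𝓘(ℝ, E) x →L[ℝ] E :=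
    mfderiv 𝓘(ℝ, E) 𝓘(ℝ, E) (extChartAt 𝓘(ℝ, E) x) x
  LinearMap.mk₂ ℝ (fun v w => (1 / 2 : ℝ) * (A (D v) (D w) - A (D w) (D v)))
    (fun v v' w => by simp only [map_add, add_apply]; ring)
    (fun c v w => by simp only [map_smul, smul_apply, smul_eq_mul]; ring)
    (fun v w w' => by simp only [map_add, add_apply]; ring)
    (fun c v w => by simp only [map_smul, smul_apply, smul_eq_mul]; ring)

theorem dOneForm_self (θ : (x : M) → TangentSpace 𝓘(ℝ, E) x →L[ℝ] ℝ) (x : M)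
    (v : TangentSpace 𝓘(ℝ, E) x) : dOneForm θ x v v = 0 := by
  simp [dOneForm]

variable [IsManifold 𝓘(ℝ, E) ∞ M]

/-- A vector field is smooth in a neighbourhood of `p`. -/
def SmoothNear (p : M) (X : VField E M) : Prop :=
  ∀ᶠ x in 𝓝 p, ContMDiffAt 𝓘(ℝ, E) 𝓘(ℝ, E).tangent ∞
    (fun y => (⟨y, X y⟩ : TangentBundle 𝓘(ℝ, E) M)) x

/-- A complex vector field is smooth in a neighbourhood of `p`. -/
def CSmoothNear (p : M) (Z : CField E M) : Prop :=
  SmoothNear p (fun x => (Z x).re) ∧ SmoothNear p (fun x => (Z x).im)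

/-- The complex bilinear extension of the Lie bracket of vector fields. -/
def bracket (Z W : CField E M) : CField E M := fun x =>
  Cplx.mk
    (VectorField.mlieBracket 𝓘(ℝ, E) (fun y => (Z y).re) (fun y => (W y).re) x
      - VectorField.mlieBracket 𝓘(ℝ, E) (fun y => (Z y).im) (fun y => (W y).im) x)
    (VectorField.mlieBracket 𝓘(ℝ, E) (fun y => (Z y).re) (fun y => (W y).im) x
      + VectorField.mlieBracket 𝓘(ℝ, E) (fun y => (Z y).im) (fun y => (W y).re) x)

/-- The conjugate vector field. -/
def conjField (Z : CField E M) : CField E M := fun x => (Z x).conj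

/-- A real vector field as a complex one. -/
def ofReal (X : VField E M) : CField E M := fun x => Cplx.mk (X x) 0

/-- A smooth real one-form on `M`. -/
def IsSmoothOneForm (θ : (x : M) → TangentSpace 𝓘(ℝ, E) x →L[ℝ] ℝ) : Prop :=
  ContMDiff 𝓘(ℝ, E) (𝓘(ℝ, E).prod 𝓘(ℝ, E →L[ℝ] ℝ)) ∞
    (fun x => Bundle.TotalSpace.mk' (E →L[ℝ] ℝ)
      (E := fun x : M => TangentSpace 𝓘(ℝ, E) x →L[ℝ] Bundle.Trivial M ℝ x) x (θ x))

/-- `e 1, …, e k` is a smooth frame, around `p`, of the family `T` of complex subspaces of the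
complexified tangent spaces. -/
def IsLocalFrame {k : ℕ} (T : (x : M) → Submodule ℂ (Cplx (TangentSpace 𝓘(ℝ, E) x))) (p : M)
    (e : Fin k → CField E M) : Prop :=
  (∀ i, CSmoothNear p (e i)) ∧
    ∀ᶠ x in 𝓝 p, LinearIndependent ℂ (fun i => e i x) ∧
      Submodule.span ℂ (Set.range fun i => e i x) = T x

end Manifold

/-! ### Almost CR structures -/

/-- An almost CR structure of CR dimension `m₀` on `M`: a smooth complex subbundle `T₁,₀` of
`TM ⊗ ℂ` of complex rank `m₀` with `T₁,₀ ∩ T₀,₁ = 0`, where `T₀,₁` is the conjugate of `T₁,₀`. -/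
structure AlmostCRStructure (m₀ : ℕ) (E : Type*) [NormedAddCommGroup E] [NormedSpace ℝ E]
    (M : Type*) [TopologicalSpace M] [ChartedSpace E M] [IsManifold 𝓘(ℝ, E) ∞ M] where
  /-- The fibres of `T₁,₀`. -/
  T10 : (x : M) → Submodule ℂ (Cplx (TangentSpace 𝓘(ℝ, E) x))
  exists_localFrame : ∀ p, ∃ e : Fin m₀ → CField E M, IsLocalFrame T10 p e
  eq_zero_of_mem : ∀ x, ∀ Z ∈ T10 x, Z.conj ∈ T10 x → Z = 0

namespace AlmostCRStructure

variable {m₀ : ℕ} {E : Type*} [NormedAddCommGroup E] [NormedSpace ℝ E]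
  {M : Type*} [TopologicalSpace M] [ChartedSpace E M] [IsManifold 𝓘(ℝ, E) ∞ M]
  (S : AlmostCRStructure m₀ E M)

/-- `Z` is a smooth local `(1,0)` vector field around `p`. -/
def IsLocalSection (p : M) (Z : CField E M) : Prop :=
  CSmoothNear p Z ∧ ∀ᶠ x in 𝓝 p, Z x ∈ S.T10 x

/-- Integrability `[Γ(T₁,₀), Γ(T₁,₀)] ⊆ Γ(T₁,₀)`, the condition for a CR structure. -/
def IsIntegrable : Prop :=
  ∀ (p : M) (Z W : CField E M), S.IsLocalSection p Z → S.IsLocalSection p W →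
    bracket Z W p ∈ S.T10 p

/-- The Levi distribution `HM = Re (T₁,₀ ⊕ T₀,₁)`, that is, the real parts of `(1,0)` vectors. -/
def H (x : M) : Submodule ℝ (TangentSpace 𝓘(ℝ, E) x) :=
  ((S.T10 x).restrictScalars ℝ).map Cplx.re

/-- Taking real parts identifies `T₁,₀` with `HM`. -/
def reEquiv (x : M) : (S.T10 x).restrictScalars ℝ ≃ₗ[ℝ] S.H x :=
  LinearEquiv.ofBijective
    ((Cplx.re.domRestrict ((S.T10 x).restrictScalars ℝ)).codRestrict (S.H x)
      (fun Z => Submodule.mem_map_of_mem Z.2)) <| by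
    constructor
    · refine (injective_iff_map_eq_zero _).2 fun Z hZ => ?_
      have h : Cplx.re (Z : Cplx (TangentSpace 𝓘(ℝ, E) x)) = 0 := congrArg Subtype.val hZ
      refine Subtype.ext (S.eq_zero_of_mem x Z Z.2 ?_)
      have hc : (Z : Cplx (TangentSpace 𝓘(ℝ, E) x)).conj = -Z := by
        refine Cplx.ext ?_ ?_
        · rw [map_neg, h, neg_zero]; exact h
        · rw [map_neg]; rfl
      rw [hc]
      exact neg_mem Z.2
    · rintro ⟨X, Z, hZ, rfl⟩
      exact ⟨⟨Z, hZ⟩, rfl⟩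

/-- The complex structure `J` of `HM`, given by `J (Z + Z̄) = i (Z - Z̄)` for `Z` in `T₁,₀`; in other
words `J (Re Z) = - Im Z = Re (i Z)`. -/
def J (x : M) : S.H x →ₗ[ℝ] S.H x where
  toFun X := ⟨-Cplx.im (((S.reEquiv x).symm X) : Cplx (TangentSpace 𝓘(ℝ, E) x)), by
    rw [← Cplx.re_I_smul]
    exact Submodule.mem_map_of_mem
      ((S.T10 x).smul_mem Complex.I ((S.reEquiv x).symm X).2)⟩
  map_add' X Y := by
    refine Subtype.ext ?_
    simp only [map_add, Submodule.coe_add, neg_add]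
  map_smul' c X := by
    refine Subtype.ext ?_
    simp only [map_smul, Submodule.coe_smul, smul_neg, RingHom.id_apply]

end AlmostCRStructure

/-! ### Pseudo-Hermitian structures -/

/-- A pseudo-Hermitian structure on the manifold `M` of dimension `2 m₀ + 1`: a CR structure of
codimension one with a one-form `θ` such that `HM = ker θ` and such that the Levi form
`L_θ(X, Y) = dθ(X, JY)` is positive definite on `HM`. -/
structure PseudoHermitianStructure (m₀ : ℕ) (E : Type*) [NormedAddCommGroup E] [NormedSpace ℝ E]
    [FiniteDimensional ℝ E] (M : Type*) [TopologicalSpace M] [ChartedSpace E M]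
    [IsManifold 𝓘(ℝ, E) ∞ M] extends AlmostCRStructure m₀ E M where
  finrank_eq : Module.finrank ℝ E = 2 * m₀ + 1
  integrable : toAlmostCRStructure.IsIntegrable
  /-- The contact form. -/
  θ : (x : M) → TangentSpace 𝓘(ℝ, E) x →L[ℝ] ℝ
  smooth_θ : IsSmoothOneForm θ
  mem_H_iff : ∀ (x : M) (X : TangentSpace 𝓘(ℝ, E) x), X ∈ toAlmostCRStructure.H x ↔ θ x X = 0
  levi_pos : ∀ (x : M) (X : toAlmostCRStructure.H x), X ≠ 0 →
    0 < dOneForm θ x X (toAlmostCRStructure.J x X)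

namespace PseudoHermitianStructure

variable {m₀ : ℕ} {E : Type*} [NormedAddCommGroup E] [NormedSpace ℝ E] [FiniteDimensional ℝ E]
  {M : Type*} [TopologicalSpace M] [ChartedSpace E M] [IsManifold 𝓘(ℝ, E) ∞ M]
  (S : PseudoHermitianStructure m₀ E M)

theorem exists_θ_eq_one (x : M) : ∃ v : TangentSpace 𝓘(ℝ, E) x, S.θ x v = 1 := by
  by_contra! hne
  have hz : ∀ v, S.θ x v = 0 := by
    intro v
    by_contra h
    exact hne ((S.θ x v)⁻¹ • v) (by simp [h])
  have htop : S.H x = ⊤ := by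
    refine eq_top_iff.2 fun v _ => (S.mem_H_iff x v).2 (hz v)
  obtain ⟨e, -, he⟩ := S.exists_localFrame x
  obtain ⟨hli, hspan⟩ := he.self_of_nhds
  have h1 : Module.finrank ℂ (S.T10 x) = m₀ := by
    rw [← hspan, finrank_span_eq_card hli, Fintype.card_fin]
  have h2 : Module.finrank ℝ (S.T10 x) = 2 * m₀ := by
    rw [finrank_real_of_complex, h1]
  have h3 : Module.finrank ℝ (S.H x) = 2 * m₀ := by
    rw [← h2]; exact (S.reEquiv x).finrank_eq.symm
  rw [htop, finrank_top] at h3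
  have h4 : Module.finrank ℝ (TangentSpace 𝓘(ℝ, E) x) = 2 * m₀ + 1 := S.finrank_eq
  omega

/-- The Reeb vector exists and is unique at every point. -/
theorem existsUnique_reeb (x : M) :
    ∃! ξ : TangentSpace 𝓘(ℝ, E) x, S.θ x ξ = 1 ∧ ∀ v, dOneForm S.θ x ξ v = 0 := by
  have : FiniteDimensional ℝ (TangentSpace 𝓘(ℝ, E) x) := inferInstanceAs (FiniteDimensional ℝ E)
  let B : S.H x →ₗ[ℝ] Module.Dual ℝ (S.H x) :=
    ((dOneForm S.θ x).compl₂ (S.H x).subtype).comp (S.H x).subtype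
  have hB : ∀ X Y, B X Y = dOneForm S.θ x X Y := fun X Y => rfl
  have hinj : Function.Injective B := by
    refine (injective_iff_map_eq_zero B).2 fun X hX => ?_
    by_contra hne
    have := S.levi_pos x X hne
    rw [← hB, hX] at this
    simp at this
  have hsurj : Function.Surjective B :=
    (LinearMap.injective_iff_surjective_of_finrank_eq_finrank
      (Subspace.dual_finrank_eq (K := ℝ) (V := S.H x)).symm).1 hinj
  obtain ⟨T, hT⟩ := S.exists_θ_eq_one x
  obtain ⟨h, hh⟩ := hsurj ((dOneForm S.θ x T).comp (S.H x).subtype)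
  have hθh : S.θ x h = 0 := (S.mem_H_iff x h).1 h.2
  have hdec : ∀ (ξ v : TangentSpace 𝓘(ℝ, E) x), S.θ x ξ = 1 → v - S.θ x v • ξ ∈ S.H x := by
    intro ξ v hξ
    rw [S.mem_H_iff]
    simp [hξ]
  refine ⟨T - h, ⟨by simp [hT, hθh], ?_⟩, ?_⟩
  · intro v
    have hξ : S.θ x (T - h) = 1 := by simp [hT, hθh]
    have key : ∀ Y : S.H x, dOneForm S.θ x (T - h) Y = 0 := by
      intro Y
      have := congrArg (fun f => f Y) hh
      have h' : dOneForm S.θ x h Y = dOneForm S.θ x T Y := this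
      rw [map_sub, LinearMap.sub_apply, h', sub_self]
    have h1 := key ⟨_, hdec _ v hξ⟩
    have h2 : v = (v - S.θ x v • (T - h : TangentSpace 𝓘(ℝ, E) x))
        + S.θ x v • (T - h : TangentSpace 𝓘(ℝ, E) x) := by
      simp
    rw [h2, map_add, map_smul, dOneForm_self, smul_zero, add_zero]
    exact h1
  · rintro ξ ⟨hξ, hξd⟩
    have hmem : ξ - (T - h : TangentSpace 𝓘(ℝ, E) x) ∈ S.H x := by
      rw [S.mem_H_iff]
      simp [hξ, hT, hθh]
    have hzero : (⟨_, hmem⟩ : S.H x) = 0 := by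
      refine hinj ?_
      rw [map_zero]
      refine LinearMap.ext fun Y => ?_
      rw [hB]
      have := congrArg (fun f => f Y) hh
      have h' : dOneForm S.θ x h Y = dOneForm S.θ x T Y := this
      simp [hξd, h']
    exact sub_eq_zero.1 (congrArg Subtype.val hzero)

/-- The Reeb vector field `ξ`, determined by `θ(ξ) = 1` and `dθ(ξ, ·) = 0`. -/
def reeb : VField E M := fun x => (S.existsUnique_reeb x).choose

theorem θ_reeb (x : M) : S.θ x (S.reeb x) = 1 := (S.existsUnique_reeb x).choose_spec.1.1

/-- The projection `π_H : TM → HM` along the Reeb direction, `π_H X = X - θ(X) ξ`. -/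
def projH (x : M) : TangentSpace 𝓘(ℝ, E) x →ₗ[ℝ] S.H x :=
  LinearMap.codRestrict (S.H x)
    (LinearMap.id - (S.θ x : TangentSpace 𝓘(ℝ, E) x →ₗ[ℝ] ℝ).smulRight (S.reeb x))
    (fun X => by
      rw [S.mem_H_iff]
      simp [S.θ_reeb x])

/-- `π_H`, viewed as an endomorphism of the tangent space. -/
def horiz (x : M) : TangentSpace 𝓘(ℝ, E) x →ₗ[ℝ] TangentSpace 𝓘(ℝ, E) x :=
  (S.H x).subtype.comp (S.projH x)

/-- The extension of `J` to the tangent space with `J ξ = 0`. -/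
def JT (x : M) : TangentSpace 𝓘(ℝ, E) x →ₗ[ℝ] TangentSpace 𝓘(ℝ, E) x :=
  (S.H x).subtype.comp ((S.J x).comp (S.projH x))

/-- The horizontal part `Z_H` of a complex tangent vector. -/
def horizC (x : M) (Z : Cplx (TangentSpace 𝓘(ℝ, E) x)) : Cplx (TangentSpace 𝓘(ℝ, E) x) :=
  Z.extend (S.horiz x)

/-- The `(1,0)` component of a complex tangent vector with respect to the decomposition
`TM ⊗ ℂ = T₁,₀ ⊕ T₀,₁ ⊕ ℂ ξ`, that is, `Z_{1,0} = (Z_H - i J Z_H) / 2`. -/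
def proj10 (x : M) (Z : Cplx (TangentSpace 𝓘(ℝ, E) x)) : Cplx (TangentSpace 𝓘(ℝ, E) x) :=
  (1 / 2 : ℂ) • (S.horizC x Z - Complex.I • Z.extend (S.JT x))

/-- The Webster metric `g_θ(X, Y) = dθ(π_H X, J π_H Y) + θ(X) θ(Y)`. -/
def webster (x : M) : TangentSpace 𝓘(ℝ, E) x →ₗ[ℝ] TangentSpace 𝓘(ℝ, E) x →ₗ[ℝ] ℝ :=
  (dOneForm S.θ x).compl₁₂ (S.horiz x) (S.JT x) +
    (LinearMap.mul ℝ ℝ).compl₁₂ (S.θ x : TangentSpace 𝓘(ℝ, E) x →ₗ[ℝ] ℝ)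
      (S.θ x : TangentSpace 𝓘(ℝ, E) x →ₗ[ℝ] ℝ)

/-- The functions `g_{i j̄} = g_θ(e_i, ē_j)`, with `g_θ` extended complex bilinearly. -/
def gComp {k : ℕ} (e : Fin k → CField E M) (i j : Fin k) (x : M) : ℂ :=
  Cplx.extendForm (S.webster x) (e i x) (e j x).conj

/-- The horizontal differential `d^H f` of a function at `x`: the restriction of `df` to `HM`. -/
def dH (f : M → ℂ) (x : M) : S.H x →ₗ[ℝ] ℂ :=
  let df : TangentSpace 𝓘(ℝ, E) x →L[ℝ] ℂ := mfderiv 𝓘(ℝ, E) 𝓘(ℝ, ℂ) f x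
  (df : TangentSpace 𝓘(ℝ, E) x →ₗ[ℝ] ℂ).comp (S.H x).subtype

/-- A local `(1,0)` vector field `u` around `p` is pseudoholomorphic at `p` if
`[u, v̄]_{1,0}(p) = 0` for all `(1,0)` vector fields `v` around `p`. -/
def IsPseudoholomorphicAt (p : M) (u : CField E M) : Prop :=
  S.IsLocalSection p u ∧
    ∀ v : CField E M, S.IsLocalSection p v → S.proj10 p (bracket u (conjField v) p) = 0

/-- `u` is quasi holomorphic at `p` if it is pseudoholomorphic at `p` and
`[[u, v̄]_H, w]_{1,0}(p) = 0` for all `(1,0)` vector fields `v`, `w` pseudoholomorphic at `p`. -/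
def IsQuasiHolomorphicAt (p : M) (u : CField E M) : Prop :=
  S.IsPseudoholomorphicAt p u ∧
    ∀ v w : CField E M, S.IsPseudoholomorphicAt p v → S.IsPseudoholomorphicAt p w →
      S.proj10 p (bracket (fun x => S.horizC x (bracket u (conjField v) x)) w p) = 0

end PseudoHermitianStructure

end PseudoHermitian

end

/-! Fix a frame `f` of T₁,₀ that is unitary at p and look for e_i = ∑ c_{im} f_m with c_{im}(p) =
δ_{im}. With [f_k, f̄_l]_{1,0} = ∑ Γ_{kl}^m f_m (`christoffel`), the Leibniz rule gives [∑ c_m f_m,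
f̄_l]_{1,0} = ∑ D_l^m f_m, where D_l^m = ∑ c_k Γ_{kl}^m - f̄_l c_m (`dbarCoeff`). Each requirement
on e_i then becomes a prescription on the 2-jet of the c_{im} at p: - pseudoholomorphy is D(p) = 0,
which fixes f̄_l c_{im}(p); - d^H g_{ij̄}(p) = 0 then fixes f_l c_{im}(p), the f̄_l derivatives
following by Hermitian symmetry (`cder_gram_comb`); - [ξ, e_i]_{1,0}(p) = 0 fixes ξ c_{im}(p); -
quasi holomorphy follows from f_n D_l^m(p) = 0, which fixes f_n f̄_l c_{im}(p). These prescriptions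
concern the value, the first derivatives along a basis of TM ⊗ ℂ, and second derivatives taken in
one order only, so they do not conflict. `exists_jet` realizes them by a quadratic polynomial in
coordinates adapted to `f`.

The reduction of quasi holomorphy is `isQuasiHolomorphicAt_comb`. For u = ∑ c_m f_m write [u, v̄]_H
= ∑ a_m f_m + ∑ b_m f̄_m. Pseudoholomorphy of u and v gives a(p) = b(p) = 0, so the (1,0) part of
the bracket with w at p is -∑ w(a_m) f_m. Since a_m is a combination of the D_l^m, which vanish at
p, only the (1,0) derivatives of D enter.

Smoothness of all coefficients rests on two facts. Cartan's formula makes dθ(X, Y) smooth for smooth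
X and Y. The Levi form -i dθ(Z, W̄) is Hermitian and positive on T₁,₀ and ignores T₀,₁ and ξ, so
inverting its Gram matrix extracts the (1,0) components (`proj10_eq_sum_coeff`). -/

noncomputable section

namespace PseudoHermitian

/-! ### Real vector fields and one-forms in a chart; Cartan's formula. -/

section RealCalculus

variable {E : Type*} [NormedAddCommGroup E] [NormedSpace ℝ E]
  {M : Type*} [TopologicalSpace M] [ChartedSpace E M] [IsManifold 𝓘(ℝ, E) ∞ M]
  {F : Type*} [NormedAddCommGroup F] [NormedSpace ℝ F]

/-- A vector field is smooth at a point. -/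
abbrev SmoothFieldAt (X : VField E M) (x : M) : Prop :=
  ContMDiffAt 𝓘(ℝ, E) 𝓘(ℝ, E).tangent ∞ (fun y => (⟨y, X y⟩ : TangentBundle 𝓘(ℝ, E) M)) x

/-- The derivative of a smooth function along a smooth vector field is smooth. -/
theorem contMDiffAt_mvfderiv_apply {f : M → F} {X : VField E M} {x : M}
    (hf : ContMDiffAt 𝓘(ℝ, E) 𝓘(ℝ, F) ∞ f x) (hX : SmoothFieldAt X x) :
    ContMDiffAt 𝓘(ℝ, E) 𝓘(ℝ, F) ∞ (fun y => mvfderiv 𝓘(ℝ, E) f y (X y)) x := by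
  have : IsManifold 𝓘(ℝ, E) 1 M := IsManifold.of_le (n := ∞) (by norm_cast)
  have h := hf.mfderiv_const (m := ∞) (by norm_cast)
  have h2 := ContMDiffAt.clm_apply_of_inCoordinates (b₁ := id) (b₂ := f) h hX hf
  exact ((contMDiff_snd_tangentBundle_modelSpace F 𝓘(ℝ, F)).contMDiffAt).comp x h2

/-- The pairing of a smooth one-form with a smooth vector field is smooth. -/
theorem IsSmoothOneForm.contMDiffAt_apply {θ : (x : M) → TangentSpace 𝓘(ℝ, E) x →L[ℝ] ℝ}
    (hθ : IsSmoothOneForm θ) {X : VField E M} {x : M} (hX : SmoothFieldAt X x) :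
    ContMDiffAt 𝓘(ℝ, E) 𝓘(ℝ, ℝ) ∞ (fun y => θ y (X y)) x := by
  have h := ContMDiffAt.clm_bundle_apply (F₁ := E) (F₂ := ℝ)
    (E₁ := fun x : M => TangentSpace 𝓘(ℝ, E) x) (E₂ := Bundle.Trivial M ℝ) (hθ x) hX
  exact (Bundle.contMDiffAt_section x).1 h

variable [CompleteSpace E]

theorem SmoothFieldAt.mlieBracket {X Y : VField E M} {x : M} (hX : SmoothFieldAt X x)
    (hY : SmoothFieldAt Y x) :
    SmoothFieldAt (VectorField.mlieBracket 𝓘(ℝ, E) X Y) x := by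
  have : IsManifold 𝓘(ℝ, E) (((⊤ : ℕ∞) : ℕ∞ω) + 1) M := ‹IsManifold 𝓘(ℝ, E) ∞ M›
  have : IsManifold 𝓘(ℝ, E) (minSmoothness ℝ 2) M := by
    rw [minSmoothness_of_isRCLikeNormedField]
    exact IsManifold.of_le (n := ∞) (by norm_cast)
  have : IsManifold 𝓘(ℝ, E) (minSmoothness ℝ 3) M := by
    rw [minSmoothness_of_isRCLikeNormedField]
    exact IsManifold.of_le (n := ∞) (by norm_cast)
  exact ContMDiffAt.mlieBracket_vectorField (m := ⊤) (n := ⊤) hX hY (by simp)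

/-- The expression of a smooth vector field in the preferred chart at `x`. -/
def fieldInChart (X : VField E M) (x : M) : E → E :=
  VectorField.mpullbackWithin 𝓘(ℝ, E) 𝓘(ℝ, E) (extChartAt 𝓘(ℝ, E) x).symm X
    (Set.range 𝓘(ℝ, E))

omit [CompleteSpace E] in
theorem fieldInChart_self (X : VField E M) (x : M) :
    fieldInChart X x (extChartAt 𝓘(ℝ, E) x x) = X x := by
  have : IsManifold 𝓘(ℝ, E) 1 M := IsManifold.of_le (n := ∞) (by norm_cast)
  have h := mfderivWithin_extChartAt_symm_inverse_apply (I := 𝓘(ℝ, E)) (x := x)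
  unfold fieldInChart VectorField.mpullbackWithin
  rw [extChartAt_to_inv x]
  exact h (X x)

theorem differentiableAt_fieldInChart {X : VField E M} {x : M} (hX : SmoothFieldAt X x) :
    DifferentiableAt ℝ (fieldInChart X x) (extChartAt 𝓘(ℝ, E) x x) := by
  have : IsManifold 𝓘(ℝ, E) 2 M := IsManifold.of_le (n := ∞) (by norm_cast)
  have h : MDifferentiableWithinAt 𝓘(ℝ, E) 𝓘(ℝ, E).tangent
      (fun y => (⟨y, X y⟩ : TangentBundle 𝓘(ℝ, E) M)) Set.univ x :=
    (hX.mdifferentiableAt (by simp)).mdifferentiableWithinAt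
  have h2 := h.differentiableWithinAt_mpullbackWithin_vectorField
  rw [← differentiableWithinAt_univ]
  convert! h2
  simp

omit [CompleteSpace E] in
theorem oneFormInChart_fieldInChart (θ : (x : M) → TangentSpace 𝓘(ℝ, E) x →L[ℝ] ℝ)
    (X : VField E M) (x : M) :
    (fun y => oneFormInChart θ x y (fieldInChart X x y)) =ᶠ[𝓝 (extChartAt 𝓘(ℝ, E) x x)]
      fun y => θ ((extChartAt 𝓘(ℝ, E) x).symm y) (X ((extChartAt 𝓘(ℝ, E) x).symm y)) := by
  have : IsManifold 𝓘(ℝ, E) 1 M := IsManifold.of_le (n := ∞) (by norm_cast)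
  filter_upwards [extChartAt_target_mem_nhds (I := 𝓘(ℝ, E)) x] with y hy
  have h := isInvertible_mfderivWithin_extChartAt_symm (I := 𝓘(ℝ, E)) hy
  have h2 : mfderivWithin 𝓘(ℝ, E) 𝓘(ℝ, E) (extChartAt 𝓘(ℝ, E) x).symm (Set.range 𝓘(ℝ, E)) y =
      mfderiv 𝓘(ℝ, E) 𝓘(ℝ, E) (extChartAt 𝓘(ℝ, E) x).symm y := by
    rw [modelWithCornersSelf_coe, Set.range_id, mfderivWithin_univ]
  have h3 := h.self_apply_inverse (X ((extChartAt 𝓘(ℝ, E) x).symm y))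
  have h4 : ∀ w : TangentSpace 𝓘(ℝ, E) y,
      mfderivWithin 𝓘(ℝ, E) 𝓘(ℝ, E) (extChartAt 𝓘(ℝ, E) x).symm (Set.range 𝓘(ℝ, E)) y w =
        mfderiv 𝓘(ℝ, E) 𝓘(ℝ, E) (extChartAt 𝓘(ℝ, E) x).symm y w := fun w => by rw [h2]
  exact congrArg (θ ((extChartAt 𝓘(ℝ, E) x).symm y)) ((h4 _).symm.trans h3)

omit [CompleteSpace E] in
theorem mlieBracket_eq_lieBracket_fieldInChart (X Y : VField E M) (x : M) :
    VectorField.mlieBracket 𝓘(ℝ, E) X Y x =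
      VectorField.lieBracket ℝ (fieldInChart X x) (fieldInChart Y x)
        (extChartAt 𝓘(ℝ, E) x x) := by
  have : IsManifold 𝓘(ℝ, E) 1 M := IsManifold.of_le (n := ∞) (by norm_cast)
  -- The tangent space at x is identified with E through the preferred chart at x, so that chart has
  -- derivative the identity at x and the pullback in the definition of the bracket disappears.
  have h : (mfderiv 𝓘(ℝ, E) 𝓘(ℝ, E) (extChartAt 𝓘(ℝ, E) x) x).inverse =
      (ContinuousLinearMap.id ℝ E : E →L[ℝ] E) :=
    (congrArg _ (mfderiv_extChartAt_self (I := 𝓘(ℝ, E)) (x := x))).trans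
      (ContinuousLinearMap.inverse_id (R := ℝ) (M := E))
  have h2 : (extChartAt 𝓘(ℝ, E) x).symm ⁻¹' Set.univ ∩ Set.range 𝓘(ℝ, E) = Set.univ := by simp
  rw [← VectorField.mlieBracketWithin_univ, VectorField.mlieBracketWithin_apply, h2]
  refine (congrArg (fun A : E →L[ℝ] E => A (VectorField.lieBracketWithin ℝ (fieldInChart X x)
    (fieldInChart Y x) Set.univ (extChartAt 𝓘(ℝ, E) x x))) h).trans ?_
  exact congrFun VectorField.lieBracketWithin_univ _

omit [IsManifold 𝓘(ℝ, E) ∞ M] [CompleteSpace E] in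
theorem mvfderiv_eq_fderiv_comp_symm {f : M → F} {x : M}
    (hf : MDifferentiableAt 𝓘(ℝ, E) 𝓘(ℝ, F) f x) (v : TangentSpace 𝓘(ℝ, E) x) :
    mvfderiv 𝓘(ℝ, E) f x v =
      fderiv ℝ (fun y => f ((extChartAt 𝓘(ℝ, E) x).symm y)) (extChartAt 𝓘(ℝ, E) x x) v := by
  have h : mvfderiv 𝓘(ℝ, E) f x v = mfderiv 𝓘(ℝ, E) 𝓘(ℝ, F) f x v := rfl
  rw [h, hf.mfderiv]
  simp [writtenInExtChartAt]
  rfl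

omit [CompleteSpace E] in
/-- The expression in a chart of a smooth one-form is differentiable. -/
theorem IsSmoothOneForm.differentiableAt_oneFormInChart [FiniteDimensional ℝ E]
    {θ : (x : M) → TangentSpace 𝓘(ℝ, E) x →L[ℝ] ℝ} (hθ : IsSmoothOneForm θ) (x : M) :
    DifferentiableAt ℝ (oneFormInChart θ x) (extChartAt 𝓘(ℝ, E) x x) := by
  have : CompleteSpace E := FiniteDimensional.complete ℝ E
  have : IsManifold 𝓘(ℝ, E) 1 M := IsManifold.of_le (n := ∞) (by norm_cast)
  have : IsManifold 𝓘(ℝ, E) 2 M := IsManifold.of_le (n := ∞) (by norm_cast)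
  have hS : ContDiffOn ℝ 1 (oneFormInChart θ x) (extChartAt 𝓘(ℝ, E) x).target := by
    refine contDiffOn_clm_apply.2 fun v y hy => ?_
    -- In finite dimension it suffices to test on each vector v. The coordinate field with constant
    -- value v is smooth, and its pairing with θ is the corresponding coefficient of θ in the chart.
    let Z : VField E M := VectorField.mpullback 𝓘(ℝ, E) 𝓘(ℝ, E) (extChartAt 𝓘(ℝ, E) x)
      (fun _ => v)
    have hZ : ∀ z ∈ (extChartAt 𝓘(ℝ, E) x).target,
        θ ((extChartAt 𝓘(ℝ, E) x).symm z) (Z ((extChartAt 𝓘(ℝ, E) x).symm z)) =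
          oneFormInChart θ x z v := by
      intro z hz
      have h1 := mfderivWithin_extChartAt_symm_comp_mfderiv_extChartAt (I := 𝓘(ℝ, E)) hz
      have h2 := (isInvertible_mfderiv_extChartAt (I := 𝓘(ℝ, E))
        ((extChartAt 𝓘(ℝ, E) x).map_target hz)).self_apply_inverse v
      have h3 : mfderivWithin 𝓘(ℝ, E) 𝓘(ℝ, E) (extChartAt 𝓘(ℝ, E) x).symm
          (Set.range 𝓘(ℝ, E)) z v = Z ((extChartAt 𝓘(ℝ, E) x).symm z) :=
        (congrArg _ h2.symm).trans (congrArg (fun A => A (Z _)) h1)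
      rw [modelWithCornersSelf_coe, Set.range_id, mfderivWithin_univ] at h3
      exact congrArg (θ ((extChartAt 𝓘(ℝ, E) x).symm z)) h3.symm
    have hsmooth : SmoothFieldAt Z ((extChartAt 𝓘(ℝ, E) x).symm y) := by
      refine ContMDiffAt.mpullback_vectorField_preimage (n := ∞) ?_ ?_
        (isInvertible_mfderiv_extChartAt ((extChartAt 𝓘(ℝ, E) x).map_target hy)) (by norm_cast)
      · exact contMDiffAt_vectorSpace_iff_contDiffAt.2 contDiffAt_const
      · exact contMDiffAt_extChartAt' (by
          simpa using (extChartAt 𝓘(ℝ, E) x).map_target hy)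
    have h2 := (hθ.contMDiffAt_apply hsmooth).contMDiffWithinAt (s := Set.univ) |>.comp y
      (contMDiffOn_extChartAt_symm (I := 𝓘(ℝ, E)) (n := ∞) x y hy) (Set.mapsTo_univ _ _)
    exact ((contMDiffWithinAt_iff_contDiffWithinAt.1 h2).congr (fun z hz => (hZ z hz).symm)
      (hZ y hy).symm).of_le (by norm_cast)
  exact ((hS _ (mem_extChartAt_target x)).contDiffAt
    (extChartAt_target_mem_nhds x)).differentiableAt (by simp)

omit [CompleteSpace E] in
/-- Cartan's formula `2 dθ(X, Y) = X θ(Y) - Y θ(X) - θ([X, Y])`. -/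
theorem IsSmoothOneForm.two_mul_dOneForm [FiniteDimensional ℝ E]
    {θ : (x : M) → TangentSpace 𝓘(ℝ, E) x →L[ℝ] ℝ} (hθ : IsSmoothOneForm θ)
    {X Y : VField E M} {x : M} (hX : SmoothFieldAt X x) (hY : SmoothFieldAt Y x) :
    2 * dOneForm θ x (X x) (Y x) =
      mvfderiv 𝓘(ℝ, E) (fun y => θ y (Y y)) x (X x) - mvfderiv 𝓘(ℝ, E) (fun y => θ y (X y)) x (Y x)
        - θ x (VectorField.mlieBracket 𝓘(ℝ, E) X Y x) := by
  have : CompleteSpace E := FiniteDimensional.complete ℝ E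
  have : IsManifold 𝓘(ℝ, E) 1 M := IsManifold.of_le (n := ∞) (by norm_cast)
  set y₀ : E := extChartAt 𝓘(ℝ, E) x x with hy₀
  -- Product rule in the chart: W θ(Z) = (D_W θ)(Z) + θ(D_W Z). On antisymmetrizing, the first terms
  -- give 2 dθ and the second ones give θ of the bracket.
  have key : ∀ {Z W : VField E M}, SmoothFieldAt Z x →
      mvfderiv 𝓘(ℝ, E) (fun y => θ y (Z y)) x (W x) =
        fderiv ℝ (oneFormInChart θ x) y₀ (W x) (Z x) +
        oneFormInChart θ x y₀ (fderiv ℝ (fieldInChart Z x) y₀ (W x)) := by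
    intro Z W hZ
    rw [mvfderiv_eq_fderiv_comp_symm ((hθ.contMDiffAt_apply hZ).mdifferentiableAt (by simp)),
      ← (oneFormInChart_fieldInChart θ Z x).fderiv_eq,
      fderiv_clm_apply (hθ.differentiableAt_oneFormInChart x) (differentiableAt_fieldInChart hZ)]
    have h : fderiv ℝ (oneFormInChart θ x) y₀ (W x) (fieldInChart Z x y₀) =
      fderiv ℝ (oneFormInChart θ x) y₀ (W x) (Z x) := congrArg _ (fieldInChart_self Z x)
    rw [← h, add_comm]
    rfl
  have hD : (mfderiv 𝓘(ℝ, E) 𝓘(ℝ, E) (extChartAt 𝓘(ℝ, E) x) x) = ContinuousLinearMap.id ℝ E :=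
    mfderiv_extChartAt_self
  have hd : dOneForm θ x (X x) (Y x) = 1 / 2 * (fderiv ℝ (oneFormInChart θ x) y₀ (X x) (Y x) -
      fderiv ℝ (oneFormInChart θ x) y₀ (Y x) (X x)) := by
    simp only [dOneForm]
    rw [LinearMap.mk₂_apply]
    have h : ∀ v : E, (mfderiv 𝓘(ℝ, E) 𝓘(ℝ, E) (extChartAt 𝓘(ℝ, E) x) x) v = v :=
      fun v => congrArg (fun A : E →L[ℝ] E => A v) hD
    have h1 := h (X x)
    have h2 := h (Y x)
    exact congrArg₂ (fun v w : E => 1 / 2 * (fderiv ℝ (oneFormInChart θ x) y₀ v w -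
      fderiv ℝ (oneFormInChart θ x) y₀ w v)) h1 h2
  have hF : ∀ v : E, oneFormInChart θ x y₀ v = θ x v := by
    intro v
    have h := fieldInChart_self (fun _ => v : VField E M) x
    have h2 := (oneFormInChart_fieldInChart θ (fun _ => v) x).self_of_nhds
    have h3 : oneFormInChart θ x y₀ v = θ ((extChartAt 𝓘(ℝ, E) x).symm y₀) v :=
      (congrArg _ h.symm).trans h2
    rw [h3, hy₀, extChartAt_to_inv]
  have hbr : θ x (VectorField.mlieBracket 𝓘(ℝ, E) X Y x) =
      oneFormInChart θ x y₀ (fderiv ℝ (fieldInChart Y x) y₀ (X x)) -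
      oneFormInChart θ x y₀ (fderiv ℝ (fieldInChart X x) y₀ (Y x)) := by
    rw [mlieBracket_eq_lieBracket_fieldInChart, ← map_sub]
    refine (hF _).symm.trans (congrArg _ ?_)
    exact congrArg₂ (fun v w : E => fderiv ℝ (fieldInChart Y x) y₀ v -
      fderiv ℝ (fieldInChart X x) y₀ w) (fieldInChart_self X x) (fieldInChart_self Y x)
  rw [key hX, key hY, hbr, hd]
  ring

end RealCalculus
end PseudoHermitian

/-! ### Linear algebra of the complexification. -/

namespace PseudoHermitian

namespace Cplx

variable {V : Type*} [AddCommGroup V] [Module ℝ V]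

theorem re_smul (c : ℂ) (Z : Cplx V) : re (c • Z) = c.re • re Z - c.im • im Z := rfl

theorem im_smul (c : ℂ) (Z : Cplx V) : im (c • Z) = c.re • im Z + c.im • re Z := rfl

@[simp] theorem re_mk (X Y : V) : re (mk X Y) = X := rfl

@[simp] theorem im_mk (X Y : V) : im (mk X Y) = Y := rfl

@[simp] theorem re_conj (Z : Cplx V) : re Z.conj = re Z := rfl

@[simp] theorem im_conj (Z : Cplx V) : im Z.conj = -im Z := rfl

@[simp] theorem conj_conj (Z : Cplx V) : Z.conj.conj = Z := ext rfl (neg_neg _)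

/-- Complex conjugation as a conjugate-linear map. -/
def conjₗ : Cplx V →ₛₗ[starRingEnd ℂ] Cplx V where
  toFun := conj
  map_add' Z W := by refine ext ?_ ?_ <;> simp [add_comm]
  map_smul' c Z := by
    refine ext ?_ ?_
    · simp [re_smul]
    · simp only [im_conj, im_smul, re_conj, Complex.conj_re, Complex.conj_im]
      module

theorem conj_add (Z W : Cplx V) : (Z + W).conj = Z.conj + W.conj := map_add conjₗ Z W

theorem conj_sub (Z W : Cplx V) : (Z - W).conj = Z.conj - W.conj := map_sub conjₗ Z W

theorem conj_smul (c : ℂ) (Z : Cplx V) : (c • Z).conj = (starRingEnd ℂ) c • Z.conj :=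
  conjₗ.map_smulₛₗ c Z

theorem conj_sum {ι : Type*} (s : Finset ι) (Z : ι → Cplx V) :
    (∑ i ∈ s, Z i).conj = ∑ i ∈ s, (Z i).conj := map_sum conjₗ Z s

/-- The complex linear extension of a real linear endomorphism, as a linear map. -/
def extendₗ (A : V →ₗ[ℝ] V) : Cplx V →ₗ[ℂ] Cplx V where
  toFun := extend A
  map_add' Z W := by refine ext ?_ ?_ <;> simp [extend]
  map_smul' c Z := by refine ext ?_ ?_ <;> simp [extend, re_smul, im_smul]

theorem extend_conj (A : V →ₗ[ℝ] V) (Z : Cplx V) : Z.conj.extend A = (Z.extend A).conj := by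
  refine ext ?_ ?_ <;> simp [extend]

/-- The complex linear extension of a complex valued real linear functional. -/
def extendFun (ℓ : V →ₗ[ℝ] ℂ) : Cplx V →ₗ[ℂ] ℂ where
  toFun Z := ℓ (re Z) + Complex.I * ℓ (im Z)
  map_add' Z W := by simp only [map_add]; ring
  map_smul' c Z := by
    simp only [re_smul, im_smul, map_sub, map_add, map_smul, Complex.real_smul, smul_eq_mul,
      RingHom.id_apply]
    conv_rhs => rw [← Complex.re_add_im c]
    linear_combination (-c.im * ℓ (im Z)) * Complex.I_mul_I

/-- The complex bilinear extension of a real bilinear form, as a bilinear map. -/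
def extendFormₗ (B : V →ₗ[ℝ] V →ₗ[ℝ] ℝ) : Cplx V →ₗ[ℂ] Cplx V →ₗ[ℂ] ℂ :=
  LinearMap.mk₂ ℂ (extendForm B)
    (fun Z Z' W => by apply Complex.ext <;> simp [extendForm] <;> ring)
    (fun c Z W => by apply Complex.ext <;> simp [extendForm, re_smul, im_smul] <;> ring)
    (fun Z W W' => by apply Complex.ext <;> simp [extendForm] <;> ring)
    (fun c Z W => by apply Complex.ext <;> simp [extendForm, re_smul, im_smul] <;> ring)

@[simp] theorem extendFormₗ_apply (B : V →ₗ[ℝ] V →ₗ[ℝ] ℝ) (Z W : Cplx V) :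
    extendFormₗ B Z W = extendForm B Z W := rfl

theorem extendForm_conj (B : V →ₗ[ℝ] V →ₗ[ℝ] ℝ) (Z W : Cplx V) :
    extendForm B Z.conj W.conj = (starRingEnd ℂ) (extendForm B Z W) := by
  apply Complex.ext <;> simp [extendForm]
  ring

theorem extendForm_swap {B : V →ₗ[ℝ] V →ₗ[ℝ] ℝ} (hB : ∀ v w, B v w = -B w v) (Z W : Cplx V) :
    extendForm B Z W = -extendForm B W Z := by
  apply Complex.ext
  · simp [extendForm, hB (re Z) (re W), hB (im Z) (im W)]
    ring
  · simp [extendForm, hB (re Z) (im W), hB (im Z) (re W)]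

end Cplx

/-! ### Derivatives along complex vectors and brackets of complex vector fields. -/

section ComplexCalculus

variable {E : Type*} [NormedAddCommGroup E] [NormedSpace ℝ E]
  {M : Type*} [TopologicalSpace M] [ChartedSpace E M]

/-- A complex valued function is smooth at a point. -/
abbrev SmoothFunAt (f : M → ℂ) (x : M) : Prop := ContMDiffAt 𝓘(ℝ, E) 𝓘(ℝ, ℂ) ∞ f x

namespace SmoothFunAt

variable {f g : M → ℂ} {x : M}

theorem mdiff (hf : SmoothFunAt (E := E) f x) : MDifferentiableAt 𝓘(ℝ, E) 𝓘(ℝ, ℂ) f x :=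
  hf.mdifferentiableAt (by simp)

theorem add (hf : SmoothFunAt (E := E) f x) (hg : SmoothFunAt (E := E) g x) :
    SmoothFunAt (E := E) (fun y => f y + g y) x := ContMDiffAt.add hf hg

theorem mul (hf : SmoothFunAt (E := E) f x) (hg : SmoothFunAt (E := E) g x) :
    SmoothFunAt (E := E) (fun y => f y * g y) x :=
  (contDiff_mul (𝕜 := ℝ) (𝔸 := ℂ) (n := ∞)).comp_contMDiffAt (hf.prodMk_space hg)

theorem clm_comp {F G : Type*} [NormedAddCommGroup F] [NormedSpace ℝ F] [NormedAddCommGroup G]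
    [NormedSpace ℝ G] {f : M → F} (L : F →L[ℝ] G) (hf : ContMDiffAt 𝓘(ℝ, E) 𝓘(ℝ, F) ∞ f x) :
    ContMDiffAt 𝓘(ℝ, E) 𝓘(ℝ, G) ∞ (fun y => L (f y)) x :=
  (L.contDiff (n := ∞)).comp_contMDiffAt hf

theorem conj (hf : SmoothFunAt (E := E) f x) :
    SmoothFunAt (E := E) (fun y => (starRingEnd ℂ) (f y)) x :=
  clm_comp (Complex.conjCLE : ℂ →L[ℝ] ℂ) hf

theorem const (c : ℂ) : SmoothFunAt (E := E) (fun _ : M => c) x := contMDiffAt_const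

theorem neg (hf : SmoothFunAt (E := E) f x) : SmoothFunAt (E := E) (fun y => -f y) x :=
  ContMDiffAt.neg hf

theorem sub (hf : SmoothFunAt (E := E) f x) (hg : SmoothFunAt (E := E) g x) :
    SmoothFunAt (E := E) (fun y => f y - g y) x := ContMDiffAt.sub hf hg

theorem sum {ι : Type*} {s : Finset ι} {f : ι → M → ℂ}
    (hf : ∀ i ∈ s, SmoothFunAt (E := E) (f i) x) :
    SmoothFunAt (E := E) (fun y => ∑ i ∈ s, f i y) x := by
  classical
  induction s using Finset.induction_on with
  | empty => simpa using const 0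
  | insert a s ha ih =>
    simp only [Finset.sum_insert ha]
    exact (hf a (by simp)).add (ih fun i hi => hf i (by simp [hi]))

theorem prod {ι : Type*} {s : Finset ι} {f : ι → M → ℂ}
    (hf : ∀ i ∈ s, SmoothFunAt (E := E) (f i) x) :
    SmoothFunAt (E := E) (fun y => ∏ i ∈ s, f i y) x := by
  classical
  induction s using Finset.induction_on with
  | empty => simpa using const 1
  | insert a s ha ih =>
    simp only [Finset.prod_insert ha]
    exact (hf a (by simp)).mul (ih fun i hi => hf i (by simp [hi]))

theorem inv (hf : SmoothFunAt (E := E) f x) (h0 : f x ≠ 0) :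
    SmoothFunAt (E := E) (fun y => (f y)⁻¹) x :=
  (contDiffAt_inv ℝ h0).comp_contMDiffAt hf

theorem re (hf : SmoothFunAt (E := E) f x) :
    ContMDiffAt 𝓘(ℝ, E) 𝓘(ℝ, ℝ) ∞ (fun y => (f y).re) x := clm_comp Complex.reCLM hf

theorem im (hf : SmoothFunAt (E := E) f x) :
    ContMDiffAt 𝓘(ℝ, E) 𝓘(ℝ, ℝ) ∞ (fun y => (f y).im) x := clm_comp Complex.imCLM hf

theorem ofReal {f : M → ℝ} (hf : ContMDiffAt 𝓘(ℝ, E) 𝓘(ℝ, ℝ) ∞ f x) :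
    SmoothFunAt (E := E) (fun y => (f y : ℂ)) x := clm_comp Complex.ofRealCLM hf

theorem mk {f g : M → ℝ} (hf : ContMDiffAt 𝓘(ℝ, E) 𝓘(ℝ, ℝ) ∞ f x)
    (hg : ContMDiffAt 𝓘(ℝ, E) 𝓘(ℝ, ℝ) ∞ g x) :
    SmoothFunAt (E := E) (fun y => (⟨f y, g y⟩ : ℂ)) x := by
  have h := (ofReal hf).add ((ofReal hg).mul (const Complex.I))
  refine h.congr_of_eventuallyEq (Filter.Eventually.of_forall fun y => ?_)
  exact Complex.mk_eq_add_mul_I _ _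

end SmoothFunAt

theorem mvfderiv_clm_comp {F G : Type*} [NormedAddCommGroup F] [NormedSpace ℝ F]
    [NormedAddCommGroup G] [NormedSpace ℝ G] {f : M → F} {x : M} (L : F →L[ℝ] G)
    (hf : MDifferentiableAt 𝓘(ℝ, E) 𝓘(ℝ, F) f x) (v : TangentSpace 𝓘(ℝ, E) x) :
    mvfderiv 𝓘(ℝ, E) (fun y => L (f y)) x v = L (mvfderiv 𝓘(ℝ, E) f x v) := by
  have h := (L.hasMFDerivAt (x := f x)).comp x hf.hasMFDerivAt
  exact congrArg (fun A => A v) h.mfderiv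

/-- The derivative of a complex valued function along a complex tangent vector. -/
def cder (f : M → ℂ) (x : M) : Cplx (TangentSpace 𝓘(ℝ, E) x) →ₗ[ℂ] ℂ :=
  Cplx.extendFun (mvfderiv 𝓘(ℝ, E) f x : TangentSpace 𝓘(ℝ, E) x →ₗ[ℝ] ℂ)

section cder

variable {f g : M → ℂ} {x : M} (Z : Cplx (TangentSpace 𝓘(ℝ, E) x))

theorem cder_apply : cder f x Z =
    mvfderiv 𝓘(ℝ, E) f x (Cplx.re Z) + Complex.I * mvfderiv 𝓘(ℝ, E) f x (Cplx.im Z) := rfl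

theorem cder_congr (h : f =ᶠ[𝓝 x] g) : cder f x Z = cder g x Z := by
  have h2 : mvfderiv 𝓘(ℝ, E) f x = mvfderiv 𝓘(ℝ, E) g x := h.mfderiv_eq
  rw [cder_apply, cder_apply, h2]

theorem cder_const (c : ℂ) : cder (fun _ : M => c) x Z = 0 := by
  rw [cder_apply, mvfderiv_const]
  simp

theorem cder_add (hf : SmoothFunAt (E := E) f x) (hg : SmoothFunAt (E := E) g x) :
    cder (fun y => f y + g y) x Z = cder f x Z + cder g x Z := by
  have h := mvfderiv_add hf.mdiff hg.mdiff
  simp only [cder_apply]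
  change mvfderiv 𝓘(ℝ, E) (f + g) x _ + _ * mvfderiv 𝓘(ℝ, E) (f + g) x _ = _
  rw [h]
  simp only [add_apply]
  ring

theorem cder_mul (hf : SmoothFunAt (E := E) f x) (hg : SmoothFunAt (E := E) g x) :
    cder (fun y => f y * g y) x Z = f x * cder g x Z + g x * cder f x Z := by
  have h : ∀ v, mvfderiv 𝓘(ℝ, E) (fun y => f y * g y) x v =
      f x * mvfderiv 𝓘(ℝ, E) g x v + g x * mvfderiv 𝓘(ℝ, E) f x v := fun v =>
    congrArg (fun A => A v) (hf.mdiff.hasMFDerivAt.mul hg.mdiff.hasMFDerivAt).mfderiv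
  simp only [cder_apply, h]
  ring

theorem cder_conj (hf : SmoothFunAt (E := E) f x) :
    cder (fun y => (starRingEnd ℂ) (f y)) x Z = (starRingEnd ℂ) (cder f x Z.conj) := by
  have h := mvfderiv_clm_comp (Complex.conjCLE : ℂ →L[ℝ] ℂ) hf.mdiff
  have h' : ∀ v, mvfderiv 𝓘(ℝ, E) (fun y => (starRingEnd ℂ) (f y)) x v =
    (starRingEnd ℂ) (mvfderiv 𝓘(ℝ, E) f x v) := h
  simp [cder_apply, h']

theorem cder_neg (hf : SmoothFunAt (E := E) f x) :
    cder (fun y => -f y) x Z = -cder f x Z := by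
  have h := cder_mul Z (.const (-1)) hf
  simp only [neg_one_mul, cder_const] at h
  simpa using h

theorem cder_const_mul (c : ℂ) (hf : SmoothFunAt (E := E) f x) :
    cder (fun y => c * f y) x Z = c * cder f x Z := by
  rw [cder_mul Z (.const c) hf, cder_const]; ring

theorem cder_sub (hf : SmoothFunAt (E := E) f x) (hg : SmoothFunAt (E := E) g x) :
    cder (fun y => f y - g y) x Z = cder f x Z - cder g x Z := by
  simp only [sub_eq_add_neg]
  rw [cder_add Z hf hg.neg, cder_neg Z hg]

theorem cder_sum {ι : Type*} {s : Finset ι} {f : ι → M → ℂ}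
    (hf : ∀ i ∈ s, SmoothFunAt (E := E) (f i) x) :
    cder (fun y => ∑ i ∈ s, f i y) x Z = ∑ i ∈ s, cder (f i) x Z := by
  classical
  induction s using Finset.induction_on with
  | empty => simp [cder_const]
  | insert a s ha ih =>
    simp only [Finset.sum_insert ha]
    rw [cder_add Z (hf a (by simp)) (SmoothFunAt.sum fun i hi => hf i (by simp [hi])),
      ih fun i hi => hf i (by simp [hi])]

end cder

variable [IsManifold 𝓘(ℝ, E) ∞ M]

namespace SmoothFieldAt

variable {X Y : VField E M} {x : M}

theorem add (hX : SmoothFieldAt X x) (hY : SmoothFieldAt Y x) :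
    SmoothFieldAt (fun y => X y + Y y) x :=
  ContMDiffAt.add_section (V := fun y : M => TangentSpace 𝓘(ℝ, E) y) hX hY

theorem sub (hX : SmoothFieldAt X x) (hY : SmoothFieldAt Y x) :
    SmoothFieldAt (fun y => X y - Y y) x :=
  ContMDiffAt.sub_section (V := fun y : M => TangentSpace 𝓘(ℝ, E) y) hX hY

theorem neg (hX : SmoothFieldAt X x) : SmoothFieldAt (fun y => -X y) x :=
  ContMDiffAt.neg_section (V := fun y : M => TangentSpace 𝓘(ℝ, E) y) hX

theorem smul {f : M → ℝ} (hf : ContMDiffAt 𝓘(ℝ, E) 𝓘(ℝ, ℝ) ∞ f x) (hX : SmoothFieldAt X x) :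
    SmoothFieldAt (fun y => f y • X y) x :=
  ContMDiffAt.smul_section (V := fun y : M => TangentSpace 𝓘(ℝ, E) y) hf hX

theorem mdiff (hX : SmoothFieldAt X x) : MDifferentiableAt 𝓘(ℝ, E) 𝓘(ℝ, E).tangent
    (fun y => (⟨y, X y⟩ : TangentBundle 𝓘(ℝ, E) M)) x :=
  hX.mdifferentiableAt (by simp)

end SmoothFieldAt

/-- A complex vector field is smooth at a point. -/
def CSmoothAt (Z : CField E M) (x : M) : Prop :=
  SmoothFieldAt (fun y => (Z y).re) x ∧ SmoothFieldAt (fun y => (Z y).im) x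


theorem cSmoothNear_iff {p : M} {Z : CField E M} :
    CSmoothNear p Z ↔ ∀ᶠ x in 𝓝 p, CSmoothAt Z x := by
  simp only [CSmoothNear, SmoothNear, CSmoothAt, Filter.eventually_and]

theorem smoothFunAt_cder {f : M → ℂ} {Z : CField E M} {x : M} (hf : SmoothFunAt (E := E) f x)
    (hZ : CSmoothAt Z x) : SmoothFunAt (E := E) (fun y => cder f y (Z y)) x :=
  (contMDiffAt_mvfderiv_apply hf hZ.1).add
    ((SmoothFunAt.const Complex.I).mul (contMDiffAt_mvfderiv_apply hf hZ.2))

namespace CSmoothAt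

variable {Z W : CField E M} {x : M}

theorem add (hZ : CSmoothAt Z x) (hW : CSmoothAt W x) : CSmoothAt (fun y => Z y + W y) x :=
  ⟨hZ.1.add hW.1, hZ.2.add hW.2⟩

theorem smul {g : M → ℂ} (hg : SmoothFunAt (E := E) g x) (hZ : CSmoothAt Z x) :
    CSmoothAt (fun y => g y • Z y) x :=
  ⟨(hZ.1.smul hg.re).sub (hZ.2.smul hg.im), (hZ.2.smul hg.re).add (hZ.1.smul hg.im)⟩

theorem zero : CSmoothAt (fun _ => 0 : CField E M) x := by
  have h := (Bundle.contMDiff_zeroSection ℝ (TangentSpace 𝓘(ℝ, E) (M := M)) (n := ∞)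
    (IB := 𝓘(ℝ, E)) (F := E)).contMDiffAt (x := x)
  exact ⟨h, h⟩

theorem sum {ι : Type*} {s : Finset ι} {Z : ι → CField E M} (hZ : ∀ i ∈ s, CSmoothAt (Z i) x) :
    CSmoothAt (fun y => ∑ i ∈ s, Z i y) x := by
  classical
  induction s using Finset.induction_on with
  | empty => simpa using zero
  | insert a s ha ih =>
    simp only [Finset.sum_insert ha]
    exact (hZ a (by simp)).add (ih fun i hi => hZ i (by simp [hi]))

theorem conjField (hZ : CSmoothAt Z x) : CSmoothAt (conjField Z) x :=
  ⟨hZ.1, hZ.2.neg⟩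

theorem bracket [CompleteSpace E] (hZ : CSmoothAt Z x) (hW : CSmoothAt W x) :
    CSmoothAt (bracket Z W) x :=
  ⟨(hZ.1.mlieBracket hW.1).sub (hZ.2.mlieBracket hW.2),
    (hZ.1.mlieBracket hW.2).add (hZ.2.mlieBracket hW.1)⟩

end CSmoothAt

section bracket

variable {Z W W' : CField E M} {x : M}

omit [IsManifold 𝓘(ℝ, E) ∞ M] in
theorem bracket_swap (Z W : CField E M) (x : M) : bracket Z W x = -bracket W Z x := by
  refine Cplx.ext ?_ ?_
  · simp only [bracket, map_neg, Cplx.re_mk]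
    rw [VectorField.mlieBracket_swap_apply,
      VectorField.mlieBracket_swap_apply (V := fun y => (Z y).im)]
    abel
  · simp only [bracket, map_neg, Cplx.im_mk]
    rw [VectorField.mlieBracket_swap_apply,
      VectorField.mlieBracket_swap_apply (V := fun y => (Z y).im)]
    abel

omit [IsManifold 𝓘(ℝ, E) ∞ M] in
theorem bracket_congr {Z' : CField E M} (h : ∀ᶠ y in 𝓝 x, Z y = Z' y)
    (h' : ∀ᶠ y in 𝓝 x, W y = W' y) :
    bracket Z W x = bracket Z' W' x := by
  have aux : ∀ {Z Z' : CField E M}, (∀ᶠ y in 𝓝 x, Z y = Z' y) →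
      (fun y => (Z y).re) =ᶠ[𝓝 x] (fun y => (Z' y).re) ∧
      (fun y => (Z y).im) =ᶠ[𝓝 x] (fun y => (Z' y).im) := fun h =>
    ⟨h.mono fun y hy => congrArg (fun A : Cplx (TangentSpace 𝓘(ℝ, E) y) => A.re) hy,
      h.mono fun y hy => congrArg (fun A : Cplx (TangentSpace 𝓘(ℝ, E) y) => A.im) hy⟩
  obtain ⟨h1, h2⟩ := aux h
  obtain ⟨h3, h4⟩ := aux h'
  simp only [bracket, h1.mlieBracket_vectorField_eq h3, h1.mlieBracket_vectorField_eq h4,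
    h2.mlieBracket_vectorField_eq h3, h2.mlieBracket_vectorField_eq h4]

variable [CompleteSpace E]

theorem mlieBracket_add_right' (X : VField E M) {Y Y' : VField E M} (hY : SmoothFieldAt Y x)
    (hY' : SmoothFieldAt Y' x) :
    VectorField.mlieBracket 𝓘(ℝ, E) X (fun y => Y y + Y' y) x =
      VectorField.mlieBracket 𝓘(ℝ, E) X Y x + VectorField.mlieBracket 𝓘(ℝ, E) X Y' x :=
  have : IsManifold 𝓘(ℝ, E) 2 M := IsManifold.of_le (n := ∞) (by norm_cast)
  VectorField.mlieBracket_add_right hY.mdiff hY'.mdiff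

theorem mlieBracket_smul_right' (X : VField E M) {Y : VField E M} {f : M → ℝ}
    (hf : ContMDiffAt 𝓘(ℝ, E) 𝓘(ℝ, ℝ) ∞ f x) (hY : SmoothFieldAt Y x) :
    VectorField.mlieBracket 𝓘(ℝ, E) X (fun y => f y • Y y) x =
      mvfderiv 𝓘(ℝ, E) f x (X x) • Y x + f x • VectorField.mlieBracket 𝓘(ℝ, E) X Y x :=
  have : IsManifold 𝓘(ℝ, E) 2 M := IsManifold.of_le (n := ∞) (by norm_cast)
  VectorField.mlieBracket_smul_right (hf.mdifferentiableAt (by simp)) hY.mdiff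

theorem mlieBracket_sub_right' (X : VField E M) {Y Y' : VField E M} (hY : SmoothFieldAt Y x)
    (hY' : SmoothFieldAt Y' x) :
    VectorField.mlieBracket 𝓘(ℝ, E) X (fun y => Y y - Y' y) x =
      VectorField.mlieBracket 𝓘(ℝ, E) X Y x - VectorField.mlieBracket 𝓘(ℝ, E) X Y' x := by
  have h := mlieBracket_smul_right' X (f := fun _ => (-1 : ℝ)) contMDiffAt_const hY'
  rw [mvfderiv_const] at h
  have h2 := mlieBracket_add_right' X hY (hY'.smul (f := fun _ => (-1 : ℝ)) contMDiffAt_const)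
  rw [h] at h2
  simpa [sub_eq_add_neg] using h2

theorem mlieBracket_neg_right' (X : VField E M) {Y : VField E M} (hY : SmoothFieldAt Y x) :
    VectorField.mlieBracket 𝓘(ℝ, E) X (fun y => -Y y) x =
      -VectorField.mlieBracket 𝓘(ℝ, E) X Y x := by
  have h := mlieBracket_smul_right' X (f := fun _ => (-1 : ℝ)) contMDiffAt_const hY
  rw [mvfderiv_const] at h
  simpa using h

theorem bracket_add_right (Z : CField E M) (hW : CSmoothAt W x) (hW' : CSmoothAt W' x) :
    bracket Z (fun y => W y + W' y) x = bracket Z W x + bracket Z W' x := by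
  refine Cplx.ext ?_ ?_
  · simp only [bracket, map_add, Cplx.re_mk, mlieBracket_add_right' _ hW.1 hW'.1,
      mlieBracket_add_right' _ hW.2 hW'.2]
    abel
  · simp only [bracket, map_add, Cplx.im_mk, mlieBracket_add_right' _ hW.1 hW'.1,
      mlieBracket_add_right' _ hW.2 hW'.2]
    abel

omit [IsManifold 𝓘(ℝ, E) ∞ M] [CompleteSpace E] in
theorem mvfderiv_re {g : M → ℂ} (hg : SmoothFunAt (E := E) g x) (v : TangentSpace 𝓘(ℝ, E) x) :
    mvfderiv 𝓘(ℝ, E) (fun y => (g y).re) x v = (mvfderiv 𝓘(ℝ, E) g x v).re :=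
  mvfderiv_clm_comp Complex.reCLM hg.mdiff v

omit [IsManifold 𝓘(ℝ, E) ∞ M] [CompleteSpace E] in
theorem mvfderiv_im {g : M → ℂ} (hg : SmoothFunAt (E := E) g x) (v : TangentSpace 𝓘(ℝ, E) x) :
    mvfderiv 𝓘(ℝ, E) (fun y => (g y).im) x v = (mvfderiv 𝓘(ℝ, E) g x v).im :=
  mvfderiv_clm_comp Complex.imCLM hg.mdiff v

/-- The real Leibniz rule applied to real and imaginary parts. Only the right slot is differentiated
against g, so Z may be any field; in particular the Reeb field can be inserted without first proving
it smooth. -/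
theorem bracket_smul_right (Z : CField E M) {g : M → ℂ} (hg : SmoothFunAt (E := E) g x)
    (hW : CSmoothAt W x) :
    bracket Z (fun y => g y • W y) x = g x • bracket Z W x + cder g x (Z x) • W x := by
  have hre : ∀ X : VField E M, VectorField.mlieBracket 𝓘(ℝ, E) X
      (fun y => (g y).re • Cplx.re (W y) - (g y).im • Cplx.im (W y)) x =
      ((mvfderiv 𝓘(ℝ, E) g x (X x)).re • Cplx.re (W x) +
        (g x).re • VectorField.mlieBracket 𝓘(ℝ, E) X (fun y => (W y).re) x) -
      ((mvfderiv 𝓘(ℝ, E) g x (X x)).im • Cplx.im (W x) +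
        (g x).im • VectorField.mlieBracket 𝓘(ℝ, E) X (fun y => (W y).im) x) := by
    intro X
    rw [mlieBracket_sub_right' X (hW.1.smul hg.re) (hW.2.smul hg.im),
      mlieBracket_smul_right' X hg.re hW.1, mlieBracket_smul_right' X hg.im hW.2,
      mvfderiv_re hg, mvfderiv_im hg]
  have him : ∀ X : VField E M, VectorField.mlieBracket 𝓘(ℝ, E) X
      (fun y => (g y).re • Cplx.im (W y) + (g y).im • Cplx.re (W y)) x =
      ((mvfderiv 𝓘(ℝ, E) g x (X x)).re • Cplx.im (W x) +
        (g x).re • VectorField.mlieBracket 𝓘(ℝ, E) X (fun y => (W y).im) x) +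
      ((mvfderiv 𝓘(ℝ, E) g x (X x)).im • Cplx.re (W x) +
        (g x).im • VectorField.mlieBracket 𝓘(ℝ, E) X (fun y => (W y).re) x) := by
    intro X
    rw [mlieBracket_add_right' X (hW.2.smul hg.re) (hW.1.smul hg.im),
      mlieBracket_smul_right' X hg.re hW.2, mlieBracket_smul_right' X hg.im hW.1,
      mvfderiv_re hg, mvfderiv_im hg]
  refine Cplx.ext ?_ ?_
  · simp only [bracket, map_add, Cplx.re_mk, Cplx.im_mk, Cplx.re_smul, Cplx.im_smul, hre, him,
      cder_apply, Complex.add_re, Complex.add_im, Complex.I_mul_re, Complex.I_mul_im]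
    module
  · simp only [bracket, map_add, Cplx.re_mk, Cplx.im_mk, Cplx.re_smul, Cplx.im_smul, hre, him,
      cder_apply, Complex.add_re, Complex.add_im, Complex.I_mul_re, Complex.I_mul_im]
    module

theorem bracket_sum_right {ι : Type*} {s : Finset ι} (Z : CField E M) {W : ι → CField E M}
    (hW : ∀ i ∈ s, CSmoothAt (W i) x) :
    bracket Z (fun y => ∑ i ∈ s, W i y) x = ∑ i ∈ s, bracket Z (W i) x := by
  classical
  induction s using Finset.induction_on with
  | empty =>
    have h := bracket_smul_right Z (g := fun _ => 0) (.const 0) (CSmoothAt.zero (x := x))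
    simpa using h
  | insert a s ha ih =>
    simp only [Finset.sum_insert ha]
    rw [bracket_add_right Z (hW a (by simp)) (CSmoothAt.sum fun i hi => hW i (by simp [hi])),
      ih fun i hi => hW i (by simp [hi])]

theorem conjField_bracket (hZ : CSmoothAt Z x) (hW : CSmoothAt W x) :
    bracket (conjField Z) (conjField W) x = (bracket Z W x).conj := by
  have h : ∀ {X Y : VField E M}, SmoothFieldAt X x →
      VectorField.mlieBracket 𝓘(ℝ, E) (fun y => -X y) Y x =
        -VectorField.mlieBracket 𝓘(ℝ, E) X Y x := by
    intro X Y hX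
    rw [VectorField.mlieBracket_swap_apply, mlieBracket_neg_right' Y hX,
      VectorField.mlieBracket_swap_apply (V := X)]
  refine Cplx.ext ?_ ?_
  · simp only [bracket, conjField, Cplx.re_mk, Cplx.re_conj, Cplx.im_conj, h hZ.2,
      mlieBracket_neg_right' _ hW.2, neg_neg]
  · simp only [bracket, conjField, Cplx.im_mk, Cplx.re_conj, Cplx.im_conj, h hZ.2,
      mlieBracket_neg_right' _ hW.2]
    abel

end bracket

end ComplexCalculus
end PseudoHermitian

/-! ### The splitting of the complexified tangent space, the form dθ and the Levi form. -/

namespace PseudoHermitian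

theorem dOneForm_swap {E : Type*} [NormedAddCommGroup E] [NormedSpace ℝ E]
    {M : Type*} [TopologicalSpace M] [ChartedSpace E M]
    (θ : (x : M) → TangentSpace 𝓘(ℝ, E) x →L[ℝ] ℝ) (x : M) (v w : TangentSpace 𝓘(ℝ, E) x) :
    dOneForm θ x v w = -dOneForm θ x w v := by
  simp only [dOneForm, LinearMap.mk₂_apply]
  ring

namespace AlmostCRStructure

variable {m₀ : ℕ} {E : Type*} [NormedAddCommGroup E] [NormedSpace ℝ E]
  {M : Type*} [TopologicalSpace M] [ChartedSpace E M] [IsManifold 𝓘(ℝ, E) ∞ M]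
  (S : AlmostCRStructure m₀ E M)

variable {S} in
theorem isLocalSection_iff {p : M} {Z : CField E M} :
    S.IsLocalSection p Z ↔ ∀ᶠ x in 𝓝 p, CSmoothAt Z x ∧ Z x ∈ S.T10 x := by
  rw [IsLocalSection, cSmoothNear_iff, Filter.eventually_and]

/-- Every `(1,0)` vector extends to a local section. -/
theorem exists_isLocalSection {x : M} {Z : Cplx (TangentSpace 𝓘(ℝ, E) x)} (hZ : Z ∈ S.T10 x) :
    ∃ Z' : CField E M, S.IsLocalSection x Z' ∧ Z' x = Z := by
  obtain ⟨e, he, hspan⟩ := S.exists_localFrame x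
  rw [← hspan.self_of_nhds.2, Submodule.mem_span_range_iff_exists_fun] at hZ
  obtain ⟨a, ha⟩ := hZ
  refine ⟨fun y => ∑ k, a k • e k y, ?_, ha⟩
  rw [isLocalSection_iff]
  have he' : ∀ᶠ y in 𝓝 x, ∀ i, CSmoothAt (e i) y :=
    Filter.eventually_all.2 fun i => cSmoothNear_iff.1 (he i)
  filter_upwards [he', hspan] with y hy hy'
  refine ⟨CSmoothAt.sum fun i _ => (hy i).smul (.const (a i)), Submodule.sum_mem _ fun i _ =>
    Submodule.smul_mem _ _ ?_⟩
  rw [← hy'.2]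
  exact Submodule.subset_span ⟨i, rfl⟩

theorem re_mem_H {x : M} {Z : Cplx (TangentSpace 𝓘(ℝ, E) x)} (hZ : Z ∈ S.T10 x) :
    Z.re ∈ S.H x := Submodule.mem_map_of_mem (p := (S.T10 x).restrictScalars ℝ) hZ

theorem im_mem_H {x : M} {Z : Cplx (TangentSpace 𝓘(ℝ, E) x)} (hZ : Z ∈ S.T10 x) :
    Z.im ∈ S.H x := by
  have h := S.re_mem_H ((S.T10 x).smul_mem (-Complex.I) hZ)
  rw [neg_smul, map_neg, Cplx.re_I_smul, neg_neg] at h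
  exact h

theorem J_re {x : M} {Z : Cplx (TangentSpace 𝓘(ℝ, E) x)} (hZ : Z ∈ S.T10 x) :
    (S.J x ⟨Z.re, S.re_mem_H hZ⟩ : TangentSpace 𝓘(ℝ, E) x) = -Z.im := by
  have h : (S.reEquiv x).symm ⟨Z.re, S.re_mem_H hZ⟩ = ⟨Z, hZ⟩ :=
    (S.reEquiv x).symm_apply_apply ⟨Z, hZ⟩
  change -Cplx.im (((S.reEquiv x).symm _ : (S.T10 x).restrictScalars ℝ) :
    Cplx (TangentSpace 𝓘(ℝ, E) x)) = _
  rw [h]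

/-- This is `J_re` for -iZ, whose real part is Im Z. -/
theorem J_im {x : M} {Z : Cplx (TangentSpace 𝓘(ℝ, E) x)} (hZ : Z ∈ S.T10 x) :
    (S.J x ⟨Z.im, S.im_mem_H hZ⟩ : TangentSpace 𝓘(ℝ, E) x) = Z.re := by
  have hm := (S.T10 x).smul_mem (-Complex.I) hZ
  have h := S.J_re hm
  have h1 : Cplx.re (-Complex.I • Z) = Z.im := by
    rw [neg_smul, map_neg, Cplx.re_I_smul, neg_neg]
  have h2 : -Cplx.im (-Complex.I • Z) = Z.re := by
    rw [neg_smul, map_neg, Cplx.im_I_smul, neg_neg]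
  rw [h2] at h
  rw [← h]
  congr 2
  exact Subtype.ext h1.symm

end AlmostCRStructure

namespace PseudoHermitianStructure

variable {m₀ : ℕ} {E : Type*} [NormedAddCommGroup E] [NormedSpace ℝ E] [FiniteDimensional ℝ E]
  {M : Type*} [TopologicalSpace M] [ChartedSpace E M] [IsManifold 𝓘(ℝ, E) ∞ M]
  (S : PseudoHermitianStructure m₀ E M) {x : M}

/-- The complex bilinear extension of `dθ`. -/
def dθC (x : M) : Cplx (TangentSpace 𝓘(ℝ, E) x) →ₗ[ℂ] Cplx (TangentSpace 𝓘(ℝ, E) x) →ₗ[ℂ] ℂ :=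
  Cplx.extendFormₗ (dOneForm S.θ x)

theorem dθC_swap (Z W : Cplx (TangentSpace 𝓘(ℝ, E) x)) : S.dθC x Z W = -S.dθC x W Z :=
  Cplx.extendForm_swap (dOneForm_swap S.θ x) Z W

theorem dθC_conj (Z W : Cplx (TangentSpace 𝓘(ℝ, E) x)) :
    S.dθC x Z.conj W.conj = (starRingEnd ℂ) (S.dθC x Z W) := Cplx.extendForm_conj _ Z W

/-- `dOneForm` at y is computed in the chart at y, which changes with y, so smoothness in y is not
visible from the definition. Cartan's formula expresses the value without charts. -/
theorem smoothFunAt_dOneForm {X Y : VField E M} (h : ∀ᶠ y in 𝓝 x, SmoothFieldAt X y)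
    (h' : ∀ᶠ y in 𝓝 x, SmoothFieldAt Y y) :
    ContMDiffAt 𝓘(ℝ, E) 𝓘(ℝ, ℝ) ∞ (fun y => dOneForm S.θ y (X y) (Y y)) x := by
  have : CompleteSpace E := FiniteDimensional.complete ℝ E
  have hX := h.self_of_nhds
  have hY := h'.self_of_nhds
  have h1 := contMDiffAt_mvfderiv_apply (S.smooth_θ.contMDiffAt_apply hY) hX
  have h2 := contMDiffAt_mvfderiv_apply (S.smooth_θ.contMDiffAt_apply hX) hY
  have h3 := S.smooth_θ.contMDiffAt_apply (hX.mlieBracket hY)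
  have h4 := (contMDiffAt_const (c := (1 / 2 : ℝ)) (n := ∞) (I := 𝓘(ℝ, E)) (I' := 𝓘(ℝ, ℝ))).smul
    ((h1.sub h2).sub h3)
  refine h4.congr_of_eventuallyEq ?_
  filter_upwards [h, h'] with y hy hy'
  have := S.smooth_θ.two_mul_dOneForm hy hy'
  simp only [smul_eq_mul, Pi.smul_apply', ← this]
  ring

theorem smoothFunAt_dθC {Z W : CField E M} (h : ∀ᶠ y in 𝓝 x, CSmoothAt Z y)
    (h' : ∀ᶠ y in 𝓝 x, CSmoothAt W y) :
    SmoothFunAt (E := E) (fun y => S.dθC y (Z y) (W y)) x := by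
  have a := h.mono fun y hy => hy.1
  have b := h.mono fun y hy => hy.2
  have c := h'.mono fun y hy => hy.1
  have d := h'.mono fun y hy => hy.2
  exact SmoothFunAt.mk ((S.smoothFunAt_dOneForm a c).sub (S.smoothFunAt_dOneForm b d))
    ((S.smoothFunAt_dOneForm a d).add (S.smoothFunAt_dOneForm b c))

theorem θ_re {Z : Cplx (TangentSpace 𝓘(ℝ, E) x)} (hZ : Z ∈ S.T10 x) : S.θ x Z.re = 0 :=
  (S.mem_H_iff x _).1 (S.re_mem_H hZ)

theorem θ_im {Z : Cplx (TangentSpace 𝓘(ℝ, E) x)} (hZ : Z ∈ S.T10 x) : S.θ x Z.im = 0 :=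
  (S.mem_H_iff x _).1 (S.im_mem_H hZ)

/-- Integrability makes `dθ` vanish on pairs of `(1,0)` vectors. -/
theorem dθC_eq_zero {Z W : Cplx (TangentSpace 𝓘(ℝ, E) x)} (hZ : Z ∈ S.T10 x) (hW : W ∈ S.T10 x) :
    S.dθC x Z W = 0 := by
  obtain ⟨Z', hZ', rfl⟩ := S.exists_isLocalSection hZ
  obtain ⟨W', hW', rfl⟩ := S.exists_isLocalSection hW
  have hb := S.integrable x Z' W' hZ' hW'
  rw [AlmostCRStructure.isLocalSection_iff] at hZ' hW'
  -- For horizontal fields the derivative terms of Cartan's formula vanish. The four real identities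
  -- then combine to 2 dθ(Z, W) = -θ([Z, W]), which is zero because the bracket is again (1,0).
  have key : ∀ X Y : VField E M, (∀ᶠ y in 𝓝 x, SmoothFieldAt X y ∧ S.θ y (X y) = 0) →
      (∀ᶠ y in 𝓝 x, SmoothFieldAt Y y ∧ S.θ y (Y y) = 0) →
      2 * dOneForm S.θ x (X x) (Y x) = -S.θ x (VectorField.mlieBracket 𝓘(ℝ, E) X Y x) := by
    intro X Y hX hY
    have hz : ∀ {X : VField E M}, (∀ᶠ y in 𝓝 x, SmoothFieldAt X y ∧ S.θ y (X y) = 0) →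
        mvfderiv 𝓘(ℝ, E) (fun y => S.θ y (X y)) x = 0 := by
      intro X hX
      have h : (fun y => S.θ y (X y)) =ᶠ[𝓝 x] fun _ => (0 : ℝ) := hX.mono fun y hy => hy.2
      have h2 : mvfderiv 𝓘(ℝ, E) (fun y => S.θ y (X y)) x =
        mvfderiv 𝓘(ℝ, E) (fun _ : M => (0 : ℝ)) x := h.mfderiv_eq
      rw [h2, mvfderiv_const]
    rw [S.smooth_θ.two_mul_dOneForm hX.self_of_nhds.1 hY.self_of_nhds.1, hz hX, hz hY]
    simp
  have a := hZ'.mono fun y hy => And.intro hy.1.1 (S.θ_re hy.2)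
  have b := hZ'.mono fun y hy => And.intro hy.1.2 (S.θ_im hy.2)
  have c := hW'.mono fun y hy => And.intro hy.1.1 (S.θ_re hy.2)
  have d := hW'.mono fun y hy => And.intro hy.1.2 (S.θ_im hy.2)
  have h1 := S.θ_re hb
  have h2 := S.θ_im hb
  simp only [bracket, Cplx.re_mk, Cplx.im_mk, map_sub, map_add] at h1 h2
  have k1 := key _ _ a c
  have k2 := key _ _ b d
  have k3 := key _ _ a d
  have k4 := key _ _ b c
  apply Complex.ext
  · change dOneForm S.θ x _ _ - dOneForm S.θ x _ _ = 0
    linarith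
  · change dOneForm S.θ x _ _ + dOneForm S.θ x _ _ = 0
    linarith

theorem dθC_conj_conj_eq_zero {Z W : Cplx (TangentSpace 𝓘(ℝ, E) x)} (hZ : Z ∈ S.T10 x)
    (hW : W ∈ S.T10 x) : S.dθC x Z.conj W.conj = 0 := by
  rw [dθC_conj, S.dθC_eq_zero hZ hW, map_zero]

theorem dθC_reeb (W : Cplx (TangentSpace 𝓘(ℝ, E) x)) :
    S.dθC x (Cplx.mk (S.reeb x) 0) W = 0 := by
  have h := (S.existsUnique_reeb x).choose_spec.1.2
  change ∀ v, dOneForm S.θ x (S.reeb x) v = 0 at h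
  apply Complex.ext <;> simp [dθC, Cplx.extendForm, h]

theorem horiz_apply (X : TangentSpace 𝓘(ℝ, E) x) : S.horiz x X = X - S.θ x X • S.reeb x := rfl

theorem horiz_of_θ_eq_zero {X : TangentSpace 𝓘(ℝ, E) x} (h : S.θ x X = 0) : S.horiz x X = X := by
  simp [horiz_apply, h]

theorem horiz_reeb : S.horiz x (S.reeb x) = 0 := by
  simp [horiz_apply, S.θ_reeb]

theorem JT_of_mem {X : TangentSpace 𝓘(ℝ, E) x} (h : X ∈ S.H x) :
    S.JT x X = S.J x ⟨X, h⟩ := by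
  have h2 : S.projH x X = ⟨X, h⟩ := Subtype.ext (S.horiz_of_θ_eq_zero ((S.mem_H_iff x X).1 h))
  change (S.J x (S.projH x X) : TangentSpace 𝓘(ℝ, E) x) = _
  rw [h2]

theorem JT_reeb : S.JT x (S.reeb x) = 0 := by
  have h2 : S.projH x (S.reeb x) = 0 := Subtype.ext S.horiz_reeb
  change (S.J x (S.projH x _) : TangentSpace 𝓘(ℝ, E) x) = _
  rw [h2, map_zero]
  rfl

theorem horizC_of_mem {Z : Cplx (TangentSpace 𝓘(ℝ, E) x)} (hZ : Z ∈ S.T10 x) :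
    S.horizC x Z = Z :=
  Cplx.ext (S.horiz_of_θ_eq_zero (S.θ_re hZ)) (S.horiz_of_θ_eq_zero (S.θ_im hZ))

theorem extend_JT_of_mem {Z : Cplx (TangentSpace 𝓘(ℝ, E) x)} (hZ : Z ∈ S.T10 x) :
    Z.extend (S.JT x) = Complex.I • Z := by
  refine Cplx.ext ?_ ?_
  · rw [Cplx.re_I_smul]
    exact (S.JT_of_mem (S.re_mem_H hZ)).trans (S.J_re hZ)
  · rw [Cplx.im_I_smul]
    exact (S.JT_of_mem (S.im_mem_H hZ)).trans (S.J_im hZ)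

theorem extend_JT_conj_of_mem {Z : Cplx (TangentSpace 𝓘(ℝ, E) x)} (hZ : Z ∈ S.T10 x) :
    Z.conj.extend (S.JT x) = -Complex.I • Z.conj := by
  rw [Cplx.extend_conj, S.extend_JT_of_mem hZ, Cplx.conj_smul, Complex.conj_I]

/-- The horizontal projection as a complex linear map. -/
def horizCₗ (x : M) : Cplx (TangentSpace 𝓘(ℝ, E) x) →ₗ[ℂ] Cplx (TangentSpace 𝓘(ℝ, E) x) :=
  Cplx.extendₗ (S.horiz x)

/-- The projection to `T₁,₀` as a complex linear map. -/
def proj10ₗ (x : M) : Cplx (TangentSpace 𝓘(ℝ, E) x) →ₗ[ℂ] Cplx (TangentSpace 𝓘(ℝ, E) x) :=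
  (1 / 2 : ℂ) • (Cplx.extendₗ (S.horiz x) - Complex.I • Cplx.extendₗ (S.JT x))

theorem proj10ₗ_apply (Z : Cplx (TangentSpace 𝓘(ℝ, E) x)) : S.proj10ₗ x Z = S.proj10 x Z := rfl

theorem horizCₗ_apply (Z : Cplx (TangentSpace 𝓘(ℝ, E) x)) : S.horizCₗ x Z = S.horizC x Z := rfl

theorem horizC_conj (Z : Cplx (TangentSpace 𝓘(ℝ, E) x)) :
    S.horizC x Z.conj = (S.horizC x Z).conj := Cplx.extend_conj _ Z

theorem proj10_of_mem {Z : Cplx (TangentSpace 𝓘(ℝ, E) x)} (hZ : Z ∈ S.T10 x) :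
    S.proj10 x Z = Z := by
  rw [proj10, S.horizC_of_mem hZ, S.extend_JT_of_mem hZ, smul_smul, Complex.I_mul_I]
  module

theorem proj10_conj_of_mem {Z : Cplx (TangentSpace 𝓘(ℝ, E) x)} (hZ : Z ∈ S.T10 x) :
    S.proj10 x Z.conj = 0 := by
  rw [proj10, S.horizC_conj, S.horizC_of_mem hZ, S.extend_JT_conj_of_mem hZ, smul_smul,
    mul_neg, Complex.I_mul_I]
  module

theorem horizC_reeb : S.horizC x (Cplx.mk (S.reeb x) 0) = 0 :=
  Cplx.ext S.horiz_reeb (map_zero (S.horiz x))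

theorem proj10_reeb : S.proj10 x (Cplx.mk (S.reeb x) 0) = 0 := by
  have h : (Cplx.mk (S.reeb x) 0).extend (S.JT x) = 0 := Cplx.ext S.JT_reeb (map_zero (S.JT x))
  rw [proj10, S.horizC_reeb, h]
  simp

/-- The decomposition `TM ⊗ ℂ = T₁,₀ + T₀,₁ + ℂ ξ`. -/
theorem exists_decomp (Z : Cplx (TangentSpace 𝓘(ℝ, E) x)) :
    ∃ W₁ ∈ S.T10 x, ∃ W₂ ∈ S.T10 x, ∃ c : ℂ,
      Z = W₁ + W₂.conj + c • Cplx.mk (S.reeb x) 0 := by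
  have key : ∀ X : TangentSpace 𝓘(ℝ, E) x, ∃ W ∈ S.T10 x,
      Cplx.mk X 0 = W + W.conj + (S.θ x X : ℂ) • Cplx.mk (S.reeb x) 0 := by
    intro X
    obtain ⟨W, hW, hWX⟩ := (S.projH x X).2
    -- The horizontal part of X is Re W, which equals W/2 plus its conjugate.
    refine ⟨(1 / 2 : ℂ) • W, (S.T10 x).smul_mem _ hW, ?_⟩
    have h2 : Cplx.re W = X - S.θ x X • S.reeb x := hWX
    refine Cplx.ext ?_ ?_
    · simp only [map_add, Cplx.re_mk, Cplx.re_conj, Cplx.re_smul, h2, Cplx.im_mk,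
        Complex.ofReal_re, Complex.ofReal_im]
      norm_num
      module
    · simp only [map_add, Cplx.im_conj, Cplx.im_smul, Cplx.im_mk, Cplx.re_mk,
        Complex.ofReal_re, Complex.ofReal_im]
      module
  obtain ⟨W, hW, h⟩ := key Z.re
  obtain ⟨W', hW', h'⟩ := key Z.im
  have hZ : Z = Cplx.mk Z.re 0 + Complex.I • Cplx.mk Z.im 0 := by
    refine Cplx.ext ?_ ?_
    · rw [map_add, Cplx.re_I_smul]; simp
    · rw [map_add, Cplx.im_I_smul]; simp
  refine ⟨W + Complex.I • W', add_mem hW ((S.T10 x).smul_mem _ hW'),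
    W - Complex.I • W', sub_mem hW ((S.T10 x).smul_mem _ hW'),
    S.θ x Z.re + Complex.I * S.θ x Z.im, ?_⟩
  refine hZ.trans ?_
  rw [h, h', Cplx.conj_sub, Cplx.conj_smul, Complex.conj_I]
  module

theorem proj10_decomp {W₁ W₂ : Cplx (TangentSpace 𝓘(ℝ, E) x)} (h₁ : W₁ ∈ S.T10 x)
    (h₂ : W₂ ∈ S.T10 x) (c : ℂ) :
    S.proj10 x (W₁ + W₂.conj + c • Cplx.mk (S.reeb x) 0) = W₁ := by
  rw [← proj10ₗ_apply, map_add, map_add, map_smul]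
  simp only [proj10ₗ_apply, S.proj10_of_mem h₁, S.proj10_conj_of_mem h₂, S.proj10_reeb]
  simp

theorem horizC_decomp {W₁ W₂ : Cplx (TangentSpace 𝓘(ℝ, E) x)} (h₁ : W₁ ∈ S.T10 x)
    (h₂ : W₂ ∈ S.T10 x) (c : ℂ) :
    S.horizC x (W₁ + W₂.conj + c • Cplx.mk (S.reeb x) 0) = W₁ + W₂.conj := by
  rw [← horizCₗ_apply, map_add, map_add, map_smul]
  simp only [horizCₗ_apply, S.horizC_conj, S.horizC_of_mem h₁, S.horizC_of_mem h₂, S.horizC_reeb]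
  simp

theorem proj10_mem (Z : Cplx (TangentSpace 𝓘(ℝ, E) x)) : S.proj10 x Z ∈ S.T10 x := by
  obtain ⟨W₁, h₁, W₂, h₂, c, rfl⟩ := S.exists_decomp Z
  rwa [S.proj10_decomp h₁ h₂]

/-- The (0,1) part of Z is the conjugate of the (1,0) part of Z̄, so `proj10` alone describes both
horizontal components. -/
theorem horizC_eq (Z : Cplx (TangentSpace 𝓘(ℝ, E) x)) :
    S.horizC x Z = S.proj10 x Z + (S.proj10 x Z.conj).conj := by
  obtain ⟨W₁, h₁, W₂, h₂, c, rfl⟩ := S.exists_decomp Z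
  have h : (W₁ + W₂.conj + c • Cplx.mk (S.reeb x) 0).conj =
      W₂ + W₁.conj + (starRingEnd ℂ) c • Cplx.mk (S.reeb x) 0 := by
    have hr : (Cplx.mk (S.reeb x) 0).conj = Cplx.mk (S.reeb x) 0 := Cplx.ext rfl (by simp)
    rw [Cplx.conj_add, Cplx.conj_add, Cplx.conj_conj, Cplx.conj_smul, hr]
    abel
  rw [h, S.proj10_decomp h₁ h₂, S.proj10_decomp h₂ h₁, S.horizC_decomp h₁ h₂]

/-- The Levi form `-i dθ(Z, W̄)`, as a sesquilinear form. -/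
def levi (x : M) (Z W : Cplx (TangentSpace 𝓘(ℝ, E) x)) : ℂ := -Complex.I * S.dθC x Z W.conj

/-- For W of type (1,0), dθ(·, W̄) vanishes on T₀,₁ by integrability and on ξ by definition of the
Reeb field. Pairing with a frame therefore reads off (1,0) components. -/
theorem levi_proj10 (Z : Cplx (TangentSpace 𝓘(ℝ, E) x)) {W : Cplx (TangentSpace 𝓘(ℝ, E) x)}
    (hW : W ∈ S.T10 x) : S.levi x (S.proj10 x Z) W = S.levi x Z W := by
  obtain ⟨W₁, h₁, W₂, h₂, c, rfl⟩ := S.exists_decomp Z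
  rw [S.proj10_decomp h₁ h₂, levi, levi, map_add, map_add, map_smul]
  simp only [LinearMap.add_apply, LinearMap.smul_apply, S.dθC_reeb,
    S.dθC_conj_conj_eq_zero h₂ hW]
  simp

theorem conj_levi (Z W : Cplx (TangentSpace 𝓘(ℝ, E) x)) :
    (starRingEnd ℂ) (S.levi x Z W) = S.levi x W Z := by
  rw [levi, levi, map_mul, ← dθC_conj, Cplx.conj_conj, S.dθC_swap Z.conj, map_neg,
    Complex.conj_I]
  ring

theorem levi_sum_smul {ι κ : Type*} [Fintype ι] [Fintype κ] (a : ι → ℂ) (b : κ → ℂ)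
    (Z : ι → Cplx (TangentSpace 𝓘(ℝ, E) x)) (W : κ → Cplx (TangentSpace 𝓘(ℝ, E) x)) :
    S.levi x (∑ i, a i • Z i) (∑ j, b j • W j) =
      ∑ i, ∑ j, a i * (starRingEnd ℂ) (b j) * S.levi x (Z i) (W j) := by
  simp only [levi, Cplx.conj_sum, Cplx.conj_smul, map_sum, map_smul, LinearMap.sum_apply,
    LinearMap.smul_apply, smul_eq_mul, Finset.mul_sum]
  rw [Finset.sum_comm]
  refine Finset.sum_congr rfl fun i _ => Finset.sum_congr rfl fun j _ => by ring

theorem levi_sum_smul_left {ι : Type*} [Fintype ι] (a : ι → ℂ)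
    (Z : ι → Cplx (TangentSpace 𝓘(ℝ, E) x)) (W : Cplx (TangentSpace 𝓘(ℝ, E) x)) :
    S.levi x (∑ i, a i • Z i) W = ∑ i, a i * S.levi x (Z i) W := by
  have h := S.levi_sum_smul a (fun _ : Fin 1 => (1 : ℂ)) Z fun _ => W
  simpa using h

/-- Since J Re Z = -Im Z and dθ is antisymmetric, the real part is 2 L_θ(Re Z, Re Z), and Re Z ≠ 0
because taking real parts is injective on T₁,₀. -/
theorem levi_self_re_pos {Z : Cplx (TangentSpace 𝓘(ℝ, E) x)} (hZ : Z ∈ S.T10 x) (h0 : Z ≠ 0) :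
    0 < (S.levi x Z Z).re := by
  have hne : (⟨Z.re, S.re_mem_H hZ⟩ : S.H x) ≠ 0 := by
    intro h
    have h2 : S.reEquiv x ⟨Z, hZ⟩ = 0 := h
    rw [LinearEquiv.map_eq_zero_iff] at h2
    exact h0 (congrArg Subtype.val h2)
  have hpos := S.levi_pos x _ hne
  rw [S.J_re hZ] at hpos
  have hsw := dOneForm_swap S.θ x Z.im Z.re
  have h : (S.levi x Z Z).re = 2 * dOneForm S.θ x Z.re (-Z.im) := by
    simp only [levi, Complex.neg_re, neg_mul, Complex.I_mul_re, neg_neg]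
    change dOneForm S.θ x Z.re (-Z.im) + dOneForm S.θ x Z.im Z.re = _
    rw [hsw, map_neg]
    ring
  rw [h]
  positivity

/-- On (1,0) vectors θ vanishes, and J acts on their conjugates as -i, which is the factor built
into `levi`. -/
theorem gComp_eq_levi {k : ℕ} {e : Fin k → CField E M} {i j : Fin k} (hi : e i x ∈ S.T10 x)
    (hj : e j x ∈ S.T10 x) : S.gComp e i j x = S.levi x (e i x) (e j x) := by
  have h : ∀ {Z W : Cplx (TangentSpace 𝓘(ℝ, E) x)}, Z ∈ S.T10 x →
      Cplx.extendForm (S.webster x) Z W =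
        S.dθC x (S.horizC x Z) (W.extend (S.JT x)) := by
    intro Z W hZ
    have h1 := S.θ_re hZ
    have h2 := S.θ_im hZ
    apply Complex.ext <;>
      simp [Cplx.extendForm, webster, h1, h2, dθC, horizC, Cplx.extend]
  rw [gComp, h hi, S.horizC_of_mem hi, S.extend_JT_conj_of_mem hj, map_smul]
  simp [levi]

end PseudoHermitianStructure

end PseudoHermitian

/-! ### Gram matrices, changes of frame and frames unitary at a point. -/

open scoped ComplexOrder MatrixOrder Matrix.Norms.L2Operator in
/-- A positive definite matrix is congruent to the identity. -/
theorem Matrix.PosDef.exists_mul_mul_conjTranspose_eq_one {n : Type*} [Fintype n] [DecidableEq n]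
    {A : Matrix n n ℂ} (hA : A.PosDef) :
    ∃ P : Matrix n n ℂ, IsUnit P.det ∧ P * A * P.conjTranspose = 1 := by
  -- Factor A = b* b with b invertible; then P = (b*)⁻¹ works.
  obtain ⟨b, hb, rfl⟩ := CStarAlgebra.isStrictlyPositive_iff_eq_star_mul_self.mp
    hA.isStrictlyPositive
  have hb' : IsUnit (star b).det := (Matrix.isUnit_iff_isUnit_det _).1 hb.star
  have h1 : (star b)⁻¹ * star b = 1 := Matrix.nonsing_inv_mul _ hb'
  refine ⟨(star b)⁻¹, (Matrix.isUnit_nonsing_inv_det_iff).2 hb', ?_⟩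
  calc (star b)⁻¹ * (star b * b) * ((star b)⁻¹).conjTranspose
      = ((star b)⁻¹ * star b) * ((star b)⁻¹ * star b).conjTranspose := by
        rw [Matrix.conjTranspose_mul, ← Matrix.star_eq_conjTranspose (star b), star_star]
        simp only [Matrix.mul_assoc]
    _ = 1 := by rw [h1]; simp

namespace PseudoHermitian

section SmoothMatrix

variable {E : Type*} [NormedAddCommGroup E] [NormedSpace ℝ E]
  {M : Type*} [TopologicalSpace M] [ChartedSpace E M]
  {n : Type*} [Fintype n] [DecidableEq n]

theorem SmoothFunAt.det {A : M → Matrix n n ℂ} {x : M}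
    (hA : ∀ i j, SmoothFunAt (E := E) (fun y => A y i j) x) :
    SmoothFunAt (E := E) (fun y => (A y).det) x := by
  simp only [Matrix.det_apply']
  exact .sum fun σ _ => (SmoothFunAt.const _).mul (.prod fun i _ => hA _ _)

/-- Cramer's rule: an entry of the inverse is the inverse determinant times the determinant of A
with one row replaced by a constant vector. -/
theorem SmoothFunAt.matrix_inv {A : M → Matrix n n ℂ} {x : M}
    (hA : ∀ i j, SmoothFunAt (E := E) (fun y => A y i j) x) (h0 : (A x).det ≠ 0) (i j : n) :
    SmoothFunAt (E := E) (fun y => (A y)⁻¹ i j) x := by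
  simp only [Matrix.inv_def, Ring.inverse_eq_inv', Matrix.smul_apply, smul_eq_mul,
    Matrix.adjugate_apply]
  refine ((SmoothFunAt.det hA).inv h0).mul (SmoothFunAt.det fun k l => ?_)
  by_cases hk : k = j
  · subst hk
    simpa using SmoothFunAt.const (E := E) (x := x) ((Pi.single i 1 : n → ℂ) l)
  · simpa [Matrix.updateRow_ne hk] using hA k l

end SmoothMatrix

section Frames

variable {E : Type*} [NormedAddCommGroup E] [NormedSpace ℝ E]
  {M : Type*} [TopologicalSpace M] [ChartedSpace E M] [IsManifold 𝓘(ℝ, E) ∞ M]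
  {k : ℕ} {T : (x : M) → Submodule ℂ (Cplx (TangentSpace 𝓘(ℝ, E) x))} {p : M}

theorem isLocalFrame_iff {e : Fin k → CField E M} : IsLocalFrame T p e ↔
    ∀ᶠ x in 𝓝 p, (∀ i, CSmoothAt (e i) x) ∧ LinearIndependent ℂ (fun i => e i x) ∧
      Submodule.span ℂ (Set.range fun i => e i x) = T x := by
  simp only [IsLocalFrame, cSmoothNear_iff]
  rw [← Filter.eventually_all, ← Filter.eventually_and]

/-- An invertible change of frame. -/
theorem IsLocalFrame.change {e : Fin k → CField E M} (he : IsLocalFrame T p e)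
    {c : M → Matrix (Fin k) (Fin k) ℂ}
    (hc : ∀ᶠ x in 𝓝 p, ∀ i j, SmoothFunAt (E := E) (fun y => c y i j) x)
    (h0 : (c p).det ≠ 0) :
    IsLocalFrame T p (fun i x => ∑ j, c x i j • e j x) := by
  rw [isLocalFrame_iff] at he ⊢
  have h0' : ∀ᶠ x in 𝓝 p, (c x).det ≠ 0 :=
    (SmoothFunAt.det hc.self_of_nhds).continuousAt.eventually_ne h0
  filter_upwards [he, hc, h0'] with x ⟨hs, hli, hspan⟩ hcx h0x
  have hle : Submodule.span ℂ (Set.range fun i => ∑ j, c x i j • e j x) ≤ T x := by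
    rw [← hspan, Submodule.span_le]
    rintro _ ⟨i, rfl⟩
    exact Submodule.sum_mem _ fun j _ => Submodule.smul_mem _ _ (Submodule.subset_span ⟨j, rfl⟩)
  have hge : T x ≤ Submodule.span ℂ (Set.range fun i => ∑ j, c x i j • e j x) := by
    rw [← hspan, Submodule.span_le]
    rintro _ ⟨i, rfl⟩
    have hi : e i x = ∑ l, (c x)⁻¹ i l • ∑ j, c x l j • e j x := by
      have h1 : (c x)⁻¹ * c x = 1 := Matrix.nonsing_inv_mul _ (isUnit_iff_ne_zero.2 h0x)
      simp only [Finset.smul_sum, smul_smul]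
      rw [Finset.sum_comm]
      simp only [← Finset.sum_smul, ← Matrix.mul_apply, h1, Matrix.one_apply]
      simp
    change e i x ∈ _
    rw [hi]
    exact Submodule.sum_mem _ fun j _ => Submodule.smul_mem _ _ (Submodule.subset_span ⟨j, rfl⟩)
  have heq := le_antisymm hle hge
  refine ⟨fun i => CSmoothAt.sum fun j _ => (hs j).smul (hcx i j), ?_, heq⟩
  -- The k new fields span a space of dimension k, hence are independent.
  rw [linearIndependent_iff_card_eq_finrank_span, Set.finrank, heq, ← hspan,
    finrank_span_eq_card hli]

end Frames

namespace PseudoHermitianStructure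

variable {m₀ : ℕ} {E : Type*} [NormedAddCommGroup E] [NormedSpace ℝ E] [FiniteDimensional ℝ E]
  {M : Type*} [TopologicalSpace M] [ChartedSpace E M] [IsManifold 𝓘(ℝ, E) ∞ M]
  (S : PseudoHermitianStructure m₀ E M) {p x : M}

/-- The Gram matrix of the Levi form. -/
def gram {k : ℕ} (f : Fin k → CField E M) (x : M) : Matrix (Fin k) (Fin k) ℂ :=
  Matrix.of fun i j => S.levi x (f i x) (f j x)

theorem gram_apply {k : ℕ} (f : Fin k → CField E M) (x : M) (i j : Fin k) :
    S.gram f x i j = S.levi x (f i x) (f j x) := rfl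

open scoped ComplexOrder in
theorem gram_posDef {k : ℕ} {f : Fin k → CField E M} (hf : ∀ i, f i x ∈ S.T10 x)
    (hli : LinearIndependent ℂ fun i => f i x) : (S.gram f x).PosDef := by
  refine Matrix.PosDef.of_dotProduct_mulVec_pos ?_ fun v hv => ?_
  · ext i j
    rw [Matrix.conjTranspose_apply]
    exact S.conj_levi _ _
  · have h : star v ⬝ᵥ (S.gram f x).mulVec v =
        S.levi x (∑ i, star v i • f i x) (∑ i, star v i • f i x) := by
      rw [S.levi_sum_smul]
      simp only [dotProduct, Matrix.mulVec, Finset.mul_sum, gram_apply]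
      refine Finset.sum_congr rfl fun i _ => Finset.sum_congr rfl fun j _ => ?_
      simp
      ring
    have hm : ∑ i, star v i • f i x ∈ S.T10 x :=
      Submodule.sum_mem _ fun i _ => Submodule.smul_mem _ _ (hf i)
    have hne : ∑ i, star v i • f i x ≠ 0 := by
      intro h0
      have := Fintype.linearIndependent_iff.1 hli _ h0
      exact hv (funext fun i => by simpa using this i)
    rw [h, Complex.pos_iff]
    refine ⟨S.levi_self_re_pos hm hne, ?_⟩
    have h2 := S.conj_levi (x := x) (∑ i, star v i • f i x) (∑ i, star v i • f i x)
    exact (Complex.conj_eq_iff_im.1 h2).symm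

open scoped ComplexOrder in
theorem gram_det_ne_zero {k : ℕ} {f : Fin k → CField E M} (hf : ∀ i, f i x ∈ S.T10 x)
    (hli : LinearIndependent ℂ fun i => f i x) : (S.gram f x).det ≠ 0 :=
  isUnit_iff_ne_zero.1 ((Matrix.isUnit_iff_isUnit_det _).1 (S.gram_posDef hf hli).isUnit)

/-- The coefficients of the `(1,0)` component of a vector in a frame. -/
def coeff {k : ℕ} (f : Fin k → CField E M) (x : M) (Z : Cplx (TangentSpace 𝓘(ℝ, E) x))
    (i : Fin k) : ℂ :=
  ∑ j, S.levi x Z (f j x) * (S.gram f x)⁻¹ j i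

/-- Pairing the expansion of the (1,0) part with each f_j gives a linear system whose matrix is the
Gram matrix, and `coeff` is its solution. This explicit form makes the coefficients of a smooth
field visibly smooth. -/
theorem proj10_eq_sum_coeff {k : ℕ} {f : Fin k → CField E M}
    (hli : LinearIndependent ℂ fun i => f i x)
    (hspan : Submodule.span ℂ (Set.range fun i => f i x) = S.T10 x)
    (Z : Cplx (TangentSpace 𝓘(ℝ, E) x)) :
    S.proj10 x Z = ∑ i, S.coeff f x Z i • f i x := by
  have hf : ∀ i, f i x ∈ S.T10 x := fun i => hspan ▸ Submodule.subset_span ⟨i, rfl⟩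
  have hm := S.proj10_mem Z
  rw [← hspan, Submodule.mem_span_range_iff_exists_fun] at hm
  obtain ⟨a, ha⟩ := hm
  have hdet : IsUnit (S.gram f x).det := isUnit_iff_ne_zero.2 (S.gram_det_ne_zero hf hli)
  have h1 : ∀ j, S.levi x Z (f j x) = ∑ i, a i * S.gram f x i j := by
    intro j
    rw [← S.levi_proj10 Z (hf j), ← ha, S.levi_sum_smul_left]
    rfl
  have h2 : ∀ i, S.coeff f x Z i = a i := by
    intro i
    have h3 : S.gram f x * (S.gram f x)⁻¹ = 1 := Matrix.mul_nonsing_inv _ hdet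
    simp only [coeff, h1, Finset.sum_mul, mul_assoc]
    rw [Finset.sum_comm]
    simp only [← Finset.mul_sum, ← Matrix.mul_apply, h3, Matrix.one_apply]
    simp
  rw [← ha]
  simp only [h2]

theorem smoothFunAt_levi {Z W : CField E M} (h : ∀ᶠ y in 𝓝 x, CSmoothAt Z y)
    (h' : ∀ᶠ y in 𝓝 x, CSmoothAt W y) :
    SmoothFunAt (E := E) (fun y => S.levi y (Z y) (W y)) x :=
  (SmoothFunAt.const _).mul (S.smoothFunAt_dθC h (h'.mono fun _ hy => hy.conjField))

theorem eventually_smoothFunAt_coeff {f : Fin m₀ → CField E M} (hf : IsLocalFrame S.T10 p f)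
    {Z : CField E M} (hZ : ∀ᶠ y in 𝓝 p, CSmoothAt Z y) :
    ∀ᶠ x in 𝓝 p, ∀ i, SmoothFunAt (E := E) (fun y => S.coeff f y (Z y) i) x := by
  rw [isLocalFrame_iff] at hf
  filter_upwards [hf.eventually_nhds, hZ.eventually_nhds] with x hx hZx i
  have hfx : ∀ i, ∀ᶠ y in 𝓝 x, CSmoothAt (f i) y := fun i => hx.mono fun y hy => hy.1 i
  obtain ⟨-, hli, hspan⟩ := hx.self_of_nhds
  have hm : ∀ i, f i x ∈ S.T10 x := fun i => hspan ▸ Submodule.subset_span ⟨i, rfl⟩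
  have hdet : (S.gram f x).det ≠ 0 := S.gram_det_ne_zero hm hli
  exact .sum fun j _ => (S.smoothFunAt_levi hZx (hfx j)).mul
    (SmoothFunAt.matrix_inv (fun a b => S.smoothFunAt_levi (hfx a) (hfx b)) hdet j i)

open scoped ComplexOrder in
/-- Local frames that are unitary at a given point. -/
theorem exists_isLocalFrame_gram_eq_one (p : M) :
    ∃ f : Fin m₀ → CField E M, IsLocalFrame S.T10 p f ∧ S.gram f p = 1 := by
  obtain ⟨f, hf⟩ := S.exists_localFrame p
  obtain ⟨-, hli, hspan⟩ := (isLocalFrame_iff.1 hf).self_of_nhds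
  have hm : ∀ i, f i p ∈ S.T10 p := fun i => hspan ▸ Submodule.subset_span ⟨i, rfl⟩
  obtain ⟨P, hP, hP1⟩ := (S.gram_posDef hm hli).exists_mul_mul_conjTranspose_eq_one
  refine ⟨_, hf.change (c := fun _ => P) (Filter.Eventually.of_forall fun x i j => .const _)
    (isUnit_iff_ne_zero.1 hP), ?_⟩
  rw [← hP1]
  ext i j
  rw [gram_apply, S.levi_sum_smul]
  simp only [Matrix.mul_apply, Finset.sum_mul, Matrix.conjTranspose_apply]
  rw [Finset.sum_comm]
  refine Finset.sum_congr rfl fun a _ => Finset.sum_congr rfl fun b _ => ?_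
  rw [gram_apply, starRingEnd_apply]
  ring

end PseudoHermitianStructure

end PseudoHermitian

/-! ### Functions with prescribed jets at p. -/

namespace PseudoHermitian

section Jets

variable {E : Type*} [NormedAddCommGroup E] [NormedSpace ℝ E]
  {M : Type*} [TopologicalSpace M] [ChartedSpace E M] [IsManifold 𝓘(ℝ, E) ∞ M] {p : M}

/-- The function with differential `ℓ` at `p` that is linear in the preferred chart at `p`. -/
def coordFun (p : M) (ℓ : TangentSpace 𝓘(ℝ, E) p →ₗ[ℝ] ℂ) (x : M) : ℂ :=
  (ℓ : E →ₗ[ℝ] ℂ) (extChartAt 𝓘(ℝ, E) p x - extChartAt 𝓘(ℝ, E) p p)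

section coordFun

variable (ℓ : TangentSpace 𝓘(ℝ, E) p →ₗ[ℝ] ℂ)

omit [IsManifold 𝓘(ℝ, E) ∞ M] in
theorem coordFun_self : coordFun p ℓ p = 0 := by
  rw [coordFun, sub_self]
  exact map_zero ℓ

variable [FiniteDimensional ℝ E]

theorem eventually_smoothFunAt_coordFun :
    ∀ᶠ x in 𝓝 p, SmoothFunAt (E := E) (coordFun p ℓ) x := by
  filter_upwards [chart_source_mem_nhds E p] with x hx
  have h : ContMDiffAt 𝓘(ℝ, E) 𝓘(ℝ, E) ∞
      (fun y => extChartAt 𝓘(ℝ, E) p y - extChartAt 𝓘(ℝ, E) p p) x :=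
    (contMDiffAt_extChartAt' hx).sub contMDiffAt_const
  let L : E →L[ℝ] ℂ := LinearMap.toContinuousLinearMap (ℓ : E →ₗ[ℝ] ℂ)
  exact SmoothFunAt.clm_comp L h

theorem mvfderiv_coordFun (v : TangentSpace 𝓘(ℝ, E) p) :
    mvfderiv 𝓘(ℝ, E) (coordFun p ℓ) p v = ℓ v := by
  rw [mvfderiv_eq_fderiv_comp_symm (eventually_smoothFunAt_coordFun ℓ).self_of_nhds.mdiff]
  let L : E →L[ℝ] ℂ := LinearMap.toContinuousLinearMap (ℓ : E →ₗ[ℝ] ℂ)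
  have h : (fun y => coordFun p ℓ ((extChartAt 𝓘(ℝ, E) p).symm y)) =ᶠ[
      𝓝 (extChartAt 𝓘(ℝ, E) p p)] fun y => L (y - extChartAt 𝓘(ℝ, E) p p) := by
    filter_upwards [extChartAt_target_mem_nhds (I := 𝓘(ℝ, E)) p] with y hy
    simp only [coordFun, (extChartAt 𝓘(ℝ, E) p).right_inv hy]
    rfl
  rw [h.fderiv_eq]
  have h2 : HasFDerivAt (fun y => L (y - extChartAt 𝓘(ℝ, E) p p)) L (extChartAt 𝓘(ℝ, E) p p) := by
    have := (L.hasFDerivAt (x := extChartAt 𝓘(ℝ, E) p p)).sub_const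
      (L (extChartAt 𝓘(ℝ, E) p p))
    simpa using this
  rw [h2.fderiv]
  rfl

theorem cder_coordFun (Z : Cplx (TangentSpace 𝓘(ℝ, E) p)) :
    cder (coordFun p ℓ) p Z = ℓ Z.re + Complex.I * ℓ Z.im := by
  rw [cder_apply, mvfderiv_coordFun, mvfderiv_coordFun]

end coordFun

variable {Z : CField E M} {f g : M → ℂ} (W : Cplx (TangentSpace 𝓘(ℝ, E) p))

theorem cder_cder_add (hf : ∀ᶠ x in 𝓝 p, SmoothFunAt (E := E) f x)
    (hg : ∀ᶠ x in 𝓝 p, SmoothFunAt (E := E) g x) (hZ : CSmoothAt Z p) :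
    cder (fun y => cder (fun z => f z + g z) y (Z y)) p W =
      cder (fun y => cder f y (Z y)) p W + cder (fun y => cder g y (Z y)) p W := by
  rw [← cder_add W (smoothFunAt_cder hf.self_of_nhds hZ) (smoothFunAt_cder hg.self_of_nhds hZ)]
  refine cder_congr W ?_
  filter_upwards [hf, hg] with y hy hy'
  exact cder_add _ hy hy'

theorem cder_cder_const_mul (c : ℂ) (hf : ∀ᶠ x in 𝓝 p, SmoothFunAt (E := E) f x)
    (hZ : CSmoothAt Z p) :
    cder (fun y => cder (fun z => c * f z) y (Z y)) p W =
      c * cder (fun y => cder f y (Z y)) p W := by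
  rw [← cder_const_mul W c (smoothFunAt_cder hf.self_of_nhds hZ)]
  refine cder_congr W ?_
  filter_upwards [hf] with y hy
  exact cder_const_mul _ c hy

theorem cder_cder_sum {ι : Type*} [Fintype ι] {f : ι → M → ℂ}
    (hf : ∀ i, ∀ᶠ x in 𝓝 p, SmoothFunAt (E := E) (f i) x) (hZ : CSmoothAt Z p) :
    cder (fun y => cder (fun z => ∑ i, f i z) y (Z y)) p W =
      ∑ i, cder (fun y => cder (f i) y (Z y)) p W := by
  rw [← cder_sum W fun i _ => smoothFunAt_cder (hf i).self_of_nhds hZ]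
  refine cder_congr W ?_
  filter_upwards [Filter.eventually_all.2 hf] with y hy
  exact cder_sum _ fun i _ => hy i

/-- Terms with an undifferentiated factor vanish at p, leaving the products of first derivatives.
Such products can correct second derivatives without disturbing the 1-jet. -/
theorem cder_cder_mul_of_eq_zero (hf : ∀ᶠ x in 𝓝 p, SmoothFunAt (E := E) f x)
    (hg : ∀ᶠ x in 𝓝 p, SmoothFunAt (E := E) g x) (hZ : CSmoothAt Z p) (hf0 : f p = 0)
    (hg0 : g p = 0) :
    cder (fun y => cder (fun z => f z * g z) y (Z y)) p W =
      cder f p W * cder g p (Z p) + cder g p W * cder f p (Z p) := by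
  have h : cder (fun y => cder (fun z => f z * g z) y (Z y)) p W =
      cder (fun y => f y * cder g y (Z y) + g y * cder f y (Z y)) p W := by
    refine cder_congr W ?_
    filter_upwards [hf, hg] with y hy hy'
    exact cder_mul _ hy hy'
  have hf1 := hf.self_of_nhds
  have hg1 := hg.self_of_nhds
  have hf2 := smoothFunAt_cder hf1 hZ
  have hg2 := smoothFunAt_cder hg1 hZ
  rw [h, cder_add W (hf1.mul hg2) (hg1.mul hf2), cder_mul W hf1 hg2, cder_mul W hg1 hf2, hf0, hg0]
  ring

end Jets

namespace PseudoHermitianStructure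

variable {m₀ : ℕ} {E : Type*} [NormedAddCommGroup E] [NormedSpace ℝ E] [FiniteDimensional ℝ E]
  {M : Type*} [TopologicalSpace M] [ChartedSpace E M] [IsManifold 𝓘(ℝ, E) ∞ M]
  (S : PseudoHermitianStructure m₀ E M) {p : M}

/-- Complex coordinates at `p` dual to `f`. -/
theorem exists_holomorphic_coords {f : Fin m₀ → CField E M} (hf : IsLocalFrame S.T10 p f)
    (h1 : S.gram f p = 1) (k : Fin m₀) :
    ∃ z : M → ℂ, (∀ᶠ x in 𝓝 p, SmoothFunAt (E := E) z x) ∧ z p = 0 ∧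
      (∀ l, cder z p (f l p) = if l = k then 1 else 0) ∧
      (∀ l, cder z p (f l p).conj = 0) ∧ cder z p (Cplx.mk (S.reeb p) 0) = 0 := by
  have hm : ∀ i, f i p ∈ S.T10 p := fun i =>
    (isLocalFrame_iff.1 hf).self_of_nhds.2.2 ▸ Submodule.subset_span ⟨i, rfl⟩
  -- This is the Levi pairing with f_k(p), restricted to real vectors. It is dual to the frame
  -- because `f` is unitary at p, and it kills T₀,₁ and ξ for the reasons behind `levi_proj10`.
  let ℓ : TangentSpace 𝓘(ℝ, E) p →ₗ[ℝ] ℂ :=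
    { toFun := fun X => -Complex.I * S.dθC p (Cplx.mk X 0) (f k p).conj
      map_add' := fun X Y => by
        have h : Cplx.mk (X + Y) 0 = Cplx.mk X 0 + Cplx.mk Y 0 :=
          Cplx.ext rfl (add_zero (0 : TangentSpace 𝓘(ℝ, E) p)).symm
        rw [h, map_add, LinearMap.add_apply, mul_add]
      map_smul' := fun c X => by
        have h : Cplx.mk (c • X) 0 = (c : ℂ) • Cplx.mk X 0 :=
          Cplx.ext (by simp) (by simp)
        rw [h, map_smul, LinearMap.smul_apply, RingHom.id_apply, Complex.real_smul, smul_eq_mul]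
        ring }
  have hℓ : ∀ Z, cder (coordFun p ℓ) p Z = S.levi p Z (f k p) := by
    intro Z
    have hZ : Z = Cplx.mk Z.re 0 + Complex.I • Cplx.mk Z.im 0 := by
      refine Cplx.ext ?_ ?_
      · rw [map_add, Cplx.re_I_smul]; simp
      · rw [map_add, Cplx.im_I_smul]; simp
    conv_rhs => rw [hZ, levi, map_add, map_smul, LinearMap.add_apply, LinearMap.smul_apply]
    rw [cder_coordFun, smul_eq_mul]
    change -Complex.I * _ + Complex.I * (-Complex.I * _) = _
    ring
  refine ⟨coordFun p ℓ, eventually_smoothFunAt_coordFun _, coordFun_self _, fun l => ?_,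
    fun l => ?_, ?_⟩
  · rw [hℓ, ← gram_apply, h1, Matrix.one_apply]
  · rw [hℓ, levi, S.dθC_conj_conj_eq_zero (hm l) (hm k), mul_zero]
  · rw [hℓ, levi, S.dθC_reeb, mul_zero]

/-- Functions with prescribed first derivatives and prescribed second derivatives in the
directions `f̄ l`, `f n`. -/
theorem exists_jet {f : Fin m₀ → CField E M} (hf : IsLocalFrame S.T10 p f)
    (h1 : S.gram f p = 1) (c₀ γ : ℂ) (α β : Fin m₀ → ℂ) (τ : Fin m₀ → Fin m₀ → ℂ) :
    ∃ c : M → ℂ, (∀ᶠ x in 𝓝 p, SmoothFunAt (E := E) c x) ∧ c p = c₀ ∧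
      (∀ l, cder c p (f l p) = α l) ∧ (∀ l, cder c p (f l p).conj = β l) ∧
      cder c p (Cplx.mk (S.reeb p) 0) = γ ∧
      ∀ n l, cder (fun y => cder c y (conjField (f l) y)) p (f n p) = τ n l := by
  have hfp := (isLocalFrame_iff.1 hf).self_of_nhds
  have hm : ∀ i, f i p ∈ S.T10 p := fun i => hfp.2.2 ▸ Submodule.subset_span ⟨i, rfl⟩
  have hfs : ∀ l, CSmoothAt (conjField (f l)) p := fun l => (hfp.1 l).conjField
  choose z hz hz0 hz1 hz2 hz3 using S.exists_holomorphic_coords hf h1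
  have hzb : ∀ k, ∀ᶠ x in 𝓝 p, SmoothFunAt (E := E) (fun y => (starRingEnd ℂ) (z k y)) x :=
    fun k => (hz k).mono fun x hx => hx.conj
  have hdzb : ∀ k Z, cder (fun y => (starRingEnd ℂ) (z k y)) p Z =
      (starRingEnd ℂ) (cder (z k) p Z.conj) := fun k Z => cder_conj Z (hz k).self_of_nhds
  have hreeb : (Cplx.mk (S.reeb p) 0).conj = Cplx.mk (S.reeb p) 0 := Cplx.ext rfl (by simp)
  -- The remaining coordinate, with differential θ at p, is dual to ξ.
  obtain ⟨t, ht, ht0, ht1⟩ : ∃ t : M → ℂ, (∀ᶠ x in 𝓝 p, SmoothFunAt (E := E) t x) ∧ t p = 0 ∧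
      ∀ Z, cder t p Z = S.θ p Z.re + Complex.I * S.θ p Z.im := by
    refine ⟨coordFun p (Complex.ofRealCLM.toLinearMap ∘ₗ
      (S.θ p : TangentSpace 𝓘(ℝ, E) p →ₗ[ℝ] ℝ)), eventually_smoothFunAt_coordFun _,
      coordFun_self _, fun Z => ?_⟩
    rw [cder_coordFun]
    rfl
  have ht2 : ∀ l, cder t p (f l p) = 0 := fun l => by
    rw [ht1, S.θ_re (hm l), S.θ_im (hm l)]; simp
  have ht3 : ∀ l, cder t p (f l p).conj = 0 := fun l => by
    rw [ht1, Cplx.re_conj, Cplx.im_conj, map_neg, S.θ_re (hm l), S.θ_im (hm l)]; simp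
  have ht4 : cder t p (Cplx.mk (S.reeb p) 0) = 1 := by
    rw [ht1, Cplx.re_mk, Cplx.im_mk, S.θ_reeb]; simp
  -- The 1-jet is realized by u = c₀ + γ t + ∑ α_k z_k + ∑ β_k z̄_k.
  obtain ⟨u, hu, hu0, hu1, hu2, hu3⟩ : ∃ u : M → ℂ, (∀ᶠ x in 𝓝 p, SmoothFunAt (E := E) u x) ∧
      u p = c₀ ∧ (∀ l, cder u p (f l p) = α l) ∧ (∀ l, cder u p (f l p).conj = β l) ∧
      cder u p (Cplx.mk (S.reeb p) 0) = γ := by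
    have hs : ∀ᶠ x in 𝓝 p, (∀ k, SmoothFunAt (E := E) (z k) x) ∧ SmoothFunAt (E := E) t x := by
      filter_upwards [Filter.eventually_all.2 hz, ht] with x h h' using ⟨h, h'⟩
    have s1 : ∀ {x}, (∀ k, SmoothFunAt (E := E) (z k) x) →
        SmoothFunAt (E := E) (fun x => ∑ k, α k * z k x) x :=
      fun h => .sum fun k _ => (SmoothFunAt.const _).mul (h k)
    have s2 : ∀ {x}, (∀ k, SmoothFunAt (E := E) (z k) x) →
        SmoothFunAt (E := E) (fun x => ∑ k, β k * (starRingEnd ℂ) (z k x)) x :=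
      fun h => .sum fun k _ => (SmoothFunAt.const _).mul (h k).conj
    have s3 : ∀ {x}, SmoothFunAt (E := E) t x →
        SmoothFunAt (E := E) (fun x => c₀ + γ * t x) x :=
      fun h => (SmoothFunAt.const _).add ((SmoothFunAt.const _).mul h)
    have hd : ∀ Z : Cplx (TangentSpace 𝓘(ℝ, E) p), cder (fun x => ((∑ k, α k * z k x) + ∑ k, β k * (starRingEnd ℂ) (z k x)) +
        (c₀ + γ * t x)) p Z = ((∑ k, α k * cder (z k) p Z) +
          ∑ k, β k * (starRingEnd ℂ) (cder (z k) p Z.conj)) + γ * cder t p Z := by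
      intro Z
      obtain ⟨hs1, hs2⟩ := hs.self_of_nhds
      rw [cder_add Z ((s1 hs1).add (s2 hs1)) (s3 hs2), cder_add Z (s1 hs1) (s2 hs1),
        cder_add Z (.const _) ((SmoothFunAt.const _).mul hs2), cder_const_mul Z _ hs2, cder_const,
        cder_sum Z fun k _ => (SmoothFunAt.const _).mul (hs1 k),
        cder_sum Z fun k _ => (SmoothFunAt.const _).mul (hs1 k).conj, zero_add]
      congr 2
      · exact Finset.sum_congr rfl fun k _ => cder_const_mul Z _ (hs1 k)
      · exact Finset.sum_congr rfl fun k _ => by rw [cder_const_mul Z _ (hs1 k).conj, hdzb]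
    refine ⟨_, hs.mono fun x h => ((s1 h.1).add (s2 h.1)).add (s3 h.2), ?_, fun l => ?_,
      fun l => ?_, ?_⟩
    · simp [hz0, ht0]
    · rw [hd]; simp [hz1, hz2, ht2]
    · rw [hd]; simp [hz1, hz2, ht3]
    · rw [hd]; simp [hz3, ht4, hreeb]
  -- The affine part u already has some second derivatives, since the fields f̄_b are not constant
  -- in the chart. The defect q is supplied by ∑ q_{ab} z_a z̄_b, because f_n f̄_l (z_a z̄_b)(p) =
  -- δ_{na} δ_{lb} while the first derivatives of z_a z̄_b vanish at p.
  let q : Fin m₀ → Fin m₀ → ℂ := fun a b =>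
    τ a b - cder (fun y => cder u y (conjField (f b) y)) p (f a p)
  have hzz : ∀ a b, ∀ᶠ x in 𝓝 p,
      SmoothFunAt (E := E) (fun y => z a y * (starRingEnd ℂ) (z b y)) x := fun a b => by
    filter_upwards [hz a, hzb b] with x hx hx' using hx.mul hx'
  have hqz : ∀ a b, ∀ᶠ x in 𝓝 p,
      SmoothFunAt (E := E) (fun y => q a b * (z a y * (starRingEnd ℂ) (z b y))) x := fun a b =>
    (hzz a b).mono fun x hx => (SmoothFunAt.const _).mul hx
  have hw : ∀ a, ∀ᶠ x in 𝓝 p, SmoothFunAt (E := E)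
      (fun y => ∑ b, q a b * (z a y * (starRingEnd ℂ) (z b y))) x := fun a =>
    (Filter.eventually_all.2 (hqz a)).mono fun x hx => .sum fun b _ => hx b
  have hww : ∀ᶠ x in 𝓝 p, SmoothFunAt (E := E)
      (fun y => ∑ a, ∑ b, q a b * (z a y * (starRingEnd ℂ) (z b y))) x :=
    (Filter.eventually_all.2 hw).mono fun x hx => .sum fun b _ => hx b
  have hw0 : ∀ Z : Cplx (TangentSpace 𝓘(ℝ, E) p),
      cder (fun y => ∑ a, ∑ b, q a b * (z a y * (starRingEnd ℂ) (z b y))) p Z = 0 := by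
    intro Z
    rw [cder_sum Z fun a _ => (hw a).self_of_nhds]
    refine Finset.sum_eq_zero fun a _ => ?_
    rw [cder_sum Z fun b _ => (hqz a b).self_of_nhds]
    refine Finset.sum_eq_zero fun b _ => ?_
    rw [cder_const_mul Z _ (hzz a b).self_of_nhds,
      cder_mul Z (hz a).self_of_nhds (hzb b).self_of_nhds]
    simp [hz0]
  have hd : ∀ Z : Cplx (TangentSpace 𝓘(ℝ, E) p), cder (fun x => u x + ∑ a, ∑ b, q a b * (z a x * (starRingEnd ℂ) (z b x))) p Z =
      cder u p Z := fun Z => by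
    rw [cder_add Z hu.self_of_nhds hww.self_of_nhds, hw0, add_zero]
  refine ⟨fun x => u x + ∑ a, ∑ b, q a b * (z a x * (starRingEnd ℂ) (z b x)), ?_, ?_,
    fun l => ?_, fun l => ?_, ?_, fun n l => ?_⟩
  · filter_upwards [hu, hww] with x hx hx' using hx.add hx'
  · simp [hz0, hu0]
  · rw [hd, hu1]
  · rw [hd, hu2]
  · rw [hd, hu3]
  · rw [cder_cder_add _ hu hww (hfs l), cder_cder_sum _ hw (hfs l)]
    have hb : ∀ a b, cder (fun y => cder (fun y => q a b * (z a y * (starRingEnd ℂ) (z b y))) y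
        (conjField (f l) y)) p (f n p) = if n = a then if l = b then q a b else 0 else 0 := by
      intro a b
      have hlc : conjField (f l) p = (f l p).conj := rfl
      rw [cder_cder_const_mul _ _ (hzz a b) (hfs l), cder_cder_mul_of_eq_zero _ (hz a) (hzb b)
        (hfs l) (hz0 a) (by simp [hz0]), hdzb, hdzb, hlc, Cplx.conj_conj, hz1, hz1, hz2, hz2]
      split_ifs <;> simp
    simp only [cder_cder_sum _ (hqz _) (hfs l), hb]
    simp [q]

end PseudoHermitianStructure

end PseudoHermitian

/-! ### The ∂̄-coefficients of a combination of frame fields, and quasi holomorphy. -/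

namespace PseudoHermitian
namespace PseudoHermitianStructure

variable {m₀ : ℕ} {E : Type*} [NormedAddCommGroup E] [NormedSpace ℝ E] [FiniteDimensional ℝ E]
  {M : Type*} [TopologicalSpace M] [ChartedSpace E M] [IsManifold 𝓘(ℝ, E) ∞ M]
  (S : PseudoHermitianStructure m₀ E M) {p : M}

/-- The coefficients of `[f k, f̄ l]_{1,0}` in the frame `f`. -/
def christoffel (f : Fin m₀ → CField E M) (k l m : Fin m₀) (x : M) : ℂ :=
  S.coeff f x (bracket (f k) (conjField (f l)) x) m

/-- The combination `∑ c m • f m`. -/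
def comb {k : ℕ} (f : Fin k → CField E M) (c : Fin k → M → ℂ) : CField E M :=
  fun x => ∑ m, c m x • f m x

/-- The coefficients of `[∑ c m • f m, f̄ l]_{1,0}` in the frame `f`. -/
def dbarCoeff (f : Fin m₀ → CField E M) (c : Fin m₀ → M → ℂ) (l m : Fin m₀) (x : M) : ℂ :=
  (∑ k, c k x * S.christoffel f k l m x) - cder (c m) x (conjField (f l) x)

variable {S}

theorem eventually_smoothFunAt_christoffel {f : Fin m₀ → CField E M}
    (hf : IsLocalFrame S.T10 p f) :
    ∀ᶠ x in 𝓝 p, ∀ k l m, SmoothFunAt (E := E) (S.christoffel f k l m) x := by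
  have : CompleteSpace E := FiniteDimensional.complete ℝ E
  have h := isLocalFrame_iff.1 hf
  refine Filter.eventually_all.2 fun k => Filter.eventually_all.2 fun l => ?_
  exact S.eventually_smoothFunAt_coeff hf
    (h.mono fun y hy => (hy.1 k).bracket (hy.1 l).conjField)

theorem eventually_smoothFunAt_dbarCoeff {f : Fin m₀ → CField E M}
    (hf : IsLocalFrame S.T10 p f) {c : Fin m₀ → M → ℂ}
    (hc : ∀ᶠ x in 𝓝 p, ∀ m, SmoothFunAt (E := E) (c m) x) :
    ∀ᶠ x in 𝓝 p, ∀ l m, SmoothFunAt (E := E) (S.dbarCoeff f c l m) x := by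
  filter_upwards [isLocalFrame_iff.1 hf, eventually_smoothFunAt_christoffel hf, hc]
    with x h hΓ hcx l m
  exact (SmoothFunAt.sum fun k _ => (hcx k).mul (hΓ k l m)).sub
    (smoothFunAt_cder (hcx m) (h.1 l).conjField)

/-- Expansion of local sections in a frame. -/
theorem eventually_eq_sum_coeff {f : Fin m₀ → CField E M} (hf : IsLocalFrame S.T10 p f)
    {v : CField E M} (hv : S.IsLocalSection p v) :
    ∀ᶠ x in 𝓝 p, v x = ∑ l, S.coeff f x (v x) l • f l x := by
  filter_upwards [isLocalFrame_iff.1 hf, AlmostCRStructure.isLocalSection_iff.1 hv]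
    with x hx hvx
  rw [← S.proj10_eq_sum_coeff hx.2.1 hx.2.2, S.proj10_of_mem hvx.2]

omit [FiniteDimensional ℝ E] in
theorem cSmoothAt_comb {k : ℕ} {f : Fin k → CField E M} {c : Fin k → M → ℂ} {x : M}
    (hf : ∀ m, CSmoothAt (f m) x) (hc : ∀ m, SmoothFunAt (E := E) (c m) x) :
    CSmoothAt (comb f c) x := CSmoothAt.sum fun m _ => (hf m).smul (hc m)

theorem bracket_comb_right {k : ℕ} {f : Fin k → CField E M} {c : Fin k → M → ℂ} {x : M}
    (hf : ∀ m, CSmoothAt (f m) x) (hc : ∀ m, SmoothFunAt (E := E) (c m) x) (Z : CField E M) :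
    bracket Z (comb f c) x =
      (∑ m, c m x • bracket Z (f m) x) + ∑ m, cder (c m) x (Z x) • f m x := by
  have : CompleteSpace E := FiniteDimensional.complete ℝ E
  rw [← Finset.sum_add_distrib]
  refine (bracket_sum_right Z fun m _ => (hf m).smul (hc m)).trans ?_
  exact Finset.sum_congr rfl fun m _ => bracket_smul_right Z (hc m) (hf m)

theorem proj10_add (x : M) (Z W : Cplx (TangentSpace 𝓘(ℝ, E) x)) :
    S.proj10 x (Z + W) = S.proj10 x Z + S.proj10 x W := map_add (S.proj10ₗ x) Z W

theorem proj10_neg (x : M) (Z : Cplx (TangentSpace 𝓘(ℝ, E) x)) :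
    S.proj10 x (-Z) = -S.proj10 x Z := map_neg (S.proj10ₗ x) Z

theorem proj10_sum_smul {ι : Type*} [Fintype ι] (x : M) (a : ι → ℂ)
    (Z : ι → Cplx (TangentSpace 𝓘(ℝ, E) x)) :
    S.proj10 x (∑ i, a i • Z i) = ∑ i, a i • S.proj10 x (Z i) := by
  simp only [← proj10ₗ_apply, map_sum, map_smul]

/-- Leibniz rule, applied after swapping the bracket so that the combination stands on the right;
the swap accounts for the minus sign before the derivative in `dbarCoeff`. -/
theorem proj10_bracket_comb_conj {f : Fin m₀ → CField E M} (hf : IsLocalFrame S.T10 p f)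
    {c : Fin m₀ → M → ℂ} (hc : ∀ᶠ x in 𝓝 p, ∀ m, SmoothFunAt (E := E) (c m) x) :
    ∀ᶠ x in 𝓝 p, ∀ l, S.proj10 x (bracket (comb f c) (conjField (f l)) x) =
      ∑ m, S.dbarCoeff f c l m x • f m x := by
  filter_upwards [isLocalFrame_iff.1 hf, hc] with x ⟨hs, hli, hspan⟩ hcx l
  have hm : ∀ i, f i x ∈ S.T10 x := fun i => hspan ▸ Submodule.subset_span ⟨i, rfl⟩
  have hΓ : ∀ k, S.proj10 x (bracket (conjField (f l)) (f k) x) =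
      -∑ m, S.christoffel f k l m x • f m x := by
    intro k
    rw [bracket_swap, proj10_neg, S.proj10_eq_sum_coeff hli hspan]
    rfl
  rw [bracket_swap, bracket_comb_right hs hcx, proj10_neg, proj10_add, proj10_sum_smul,
    proj10_sum_smul]
  simp only [hΓ, S.proj10_of_mem (hm _), dbarCoeff, sub_smul, Finset.sum_smul, smul_neg,
    Finset.smul_sum, smul_smul, Finset.sum_sub_distrib, Finset.sum_neg_distrib]
  rw [Finset.sum_comm]
  abel

/-- The (1,0) part of [u, v̄] is tensorial in v̄: derivatives of the coefficients of v̄ multiply the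
f̄_l, which `proj10` kills. Testing against the frame is therefore enough. -/
theorem proj10_bracket_comb_conj_section {f : Fin m₀ → CField E M} (hf : IsLocalFrame S.T10 p f)
    {c : Fin m₀ → M → ℂ} (hc : ∀ᶠ x in 𝓝 p, ∀ m, SmoothFunAt (E := E) (c m) x)
    {v : CField E M} (hv : S.IsLocalSection p v) :
    ∀ᶠ x in 𝓝 p, S.proj10 x (bracket (comb f c) (conjField v) x) =
      ∑ m, (∑ l, (starRingEnd ℂ) (S.coeff f x (v x) l) * S.dbarCoeff f c l m x) • f m x := by
  have hvs := (AlmostCRStructure.isLocalSection_iff.1 hv).mono fun x hx => hx.1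
  filter_upwards [isLocalFrame_iff.1 hf, proj10_bracket_comb_conj hf hc,
    S.eventually_smoothFunAt_coeff hf hvs, (eventually_eq_sum_coeff hf hv).eventually_nhds]
    with x ⟨hs, hli, hspan⟩ hx hvx hvx'
  have hm : ∀ i, f i x ∈ S.T10 x := fun i => hspan ▸ Submodule.subset_span ⟨i, rfl⟩
  have h : ∀ᶠ y in 𝓝 x, conjField v y =
      comb (fun l => conjField (f l)) (fun l y => (starRingEnd ℂ) (S.coeff f y (v y) l)) y := by
    filter_upwards [hvx'] with y hy
    change (v y).conj = ∑ l, _ • (f l y).conj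
    conv_lhs => rw [hy, Cplx.conj_sum]
    simp only [Cplx.conj_smul]
  have hz : ∀ l, S.proj10 x (conjField (f l) x) = 0 := fun l => S.proj10_conj_of_mem (hm l)
  rw [bracket_congr (Filter.Eventually.of_forall fun _ => rfl) h,
    bracket_comb_right (fun l => (hs l).conjField) (fun l => (hvx l).conj), proj10_add,
    proj10_sum_smul, proj10_sum_smul]
  simp only [hx, hz, smul_zero, Finset.sum_const_zero, add_zero, Finset.smul_sum, smul_smul,
    Finset.sum_smul]
  rw [Finset.sum_comm]

theorem isLocalSection_comb {f : Fin m₀ → CField E M} (hf : IsLocalFrame S.T10 p f)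
    {c : Fin m₀ → M → ℂ} (hc : ∀ᶠ x in 𝓝 p, ∀ m, SmoothFunAt (E := E) (c m) x) :
    S.IsLocalSection p (comb f c) := by
  rw [AlmostCRStructure.isLocalSection_iff]
  filter_upwards [isLocalFrame_iff.1 hf, hc] with x ⟨hs, hli, hspan⟩ hcx
  refine ⟨cSmoothAt_comb hs hcx, Submodule.sum_mem _ fun m _ =>
    Submodule.smul_mem _ _ ?_⟩
  rw [← hspan]
  exact Submodule.subset_span ⟨m, rfl⟩

theorem isPseudoholomorphicAt_comb {f : Fin m₀ → CField E M} (hf : IsLocalFrame S.T10 p f)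
    {c : Fin m₀ → M → ℂ} (hc : ∀ᶠ x in 𝓝 p, ∀ m, SmoothFunAt (E := E) (c m) x)
    (h0 : ∀ l m, S.dbarCoeff f c l m p = 0) : S.IsPseudoholomorphicAt p (comb f c) := by
  refine ⟨isLocalSection_comb hf hc, fun v hv => ?_⟩
  rw [(proj10_bracket_comb_conj_section hf hc hv).self_of_nhds]
  simp [h0]

/-- A combination of frame fields is quasi holomorphic at `p` when its `∂̄`-coefficients vanish at
`p` to first order in the `(1,0)` directions. -/
theorem isQuasiHolomorphicAt_comb {f : Fin m₀ → CField E M} (hf : IsLocalFrame S.T10 p f)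
    {c : Fin m₀ → M → ℂ} (hc : ∀ᶠ x in 𝓝 p, ∀ m, SmoothFunAt (E := E) (c m) x)
    (h0 : ∀ l m, S.dbarCoeff f c l m p = 0)
    (h1 : ∀ n l m, cder (S.dbarCoeff f c l m) p (f n p) = 0) :
    S.IsQuasiHolomorphicAt p (comb f c) := by
  have : CompleteSpace E := FiniteDimensional.complete ℝ E
  have hu := isPseudoholomorphicAt_comb hf hc h0
  refine ⟨hu, fun v w hv hw => ?_⟩
  have hvs := (AlmostCRStructure.isLocalSection_iff.1 hv.1).mono fun x hx => hx.1
  have hus := (AlmostCRStructure.isLocalSection_iff.1 hu.1).mono fun x hx => hx.1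
  have hff := isLocalFrame_iff.1 hf
  have hp0 : S.proj10 p 0 = 0 := map_zero (S.proj10ₗ p)
  obtain ⟨hs, hli, hspan⟩ := hff.self_of_nhds
  have hm : ∀ i, f i p ∈ S.T10 p := fun i => hspan ▸ Submodule.subset_span ⟨i, rfl⟩
  -- These are the components of [u, v̄]_H along f_m and f̄_m. The second one comes from the
  -- conjugate of [u, v̄] being -[v, ū].
  let a : Fin m₀ → M → ℂ := fun m x =>
    ∑ l, (starRingEnd ℂ) (S.coeff f x (v x) l) * S.dbarCoeff f c l m x
  let b : Fin m₀ → M → ℂ := fun m x =>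
    -(starRingEnd ℂ) (S.coeff f x (bracket v (conjField (comb f c)) x) m)
  have hvc := (S.eventually_smoothFunAt_coeff hf hvs).self_of_nhds
  have hG := (eventually_smoothFunAt_dbarCoeff hf hc).self_of_nhds
  have ha : ∀ m, SmoothFunAt (E := E) (a m) p := fun m =>
    .sum fun l _ => (hvc l).conj.mul (hG l m)
  have hb : ∀ m, SmoothFunAt (E := E) (b m) p := fun m => by
    have h : ∀ᶠ y in 𝓝 p, CSmoothAt (bracket v (conjField (comb f c))) y := by
      filter_upwards [hvs, hus] with y hy hy' using hy.bracket hy'.conjField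
    exact ((S.eventually_smoothFunAt_coeff hf h).self_of_nhds m).conj.neg
  have ha0 : ∀ m, a m p = 0 := fun m => by simp [a, h0]
  have hb0 : ∀ m, b m p = 0 := by
    have h := hv.2 _ hu.1
    rw [S.proj10_eq_sum_coeff hli hspan] at h
    have h2 := Fintype.linearIndependent_iff.1 hli _ h
    intro m
    simp [b, h2 m]
  -- The ∂̄-coefficients vanish at p, so derivatives of the coefficients of v do not contribute;
  -- derivatives of the ∂̄-coefficients along the (1,0) vector w(p) vanish by `h1`.
  have hda : ∀ m, cder (a m) p (w p) = 0 := by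
    have h : ∀ m n, cder (a m) p (f n p) = 0 := by
      intro m n
      simp only [a]
      rw [cder_sum _ fun l _ => (hvc l).conj.mul (hG l m)]
      refine Finset.sum_eq_zero fun l _ => ?_
      rw [cder_mul _ (hvc l).conj (hG l m), h0, h1]
      ring
    intro m
    rw [(eventually_eq_sum_coeff hf hw.1).self_of_nhds, map_sum]
    refine Finset.sum_eq_zero fun n _ => ?_
    rw [map_smul, h, smul_zero]
  have hA : ∀ᶠ x in 𝓝 p, S.horizC x (bracket (comb f c) (conjField v) x) =
      comb f a x + comb (fun m => conjField (f m)) b x := by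
    filter_upwards [hff, proj10_bracket_comb_conj_section hf hc hv.1, hvs, hus]
      with x ⟨_, hlix, hspanx⟩ hx hvx hux
    have h2 : (bracket (comb f c) (conjField v) x).conj =
        -bracket v (conjField (comb f c)) x := by
      rw [← conjField_bracket hux hvx.conjField, bracket_swap]
      have : conjField (conjField v) = v := funext fun y => Cplx.conj_conj _
      rw [this]
    rw [S.horizC_eq, hx, h2, proj10_neg, S.proj10_eq_sum_coeff hlix hspanx,
      ← Finset.sum_neg_distrib, Cplx.conj_sum]
    congr 1
    refine Finset.sum_congr rfl fun m _ => ?_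
    rw [← neg_smul, Cplx.conj_smul, map_neg]
    rfl
  -- Terms with an undifferentiated a_m or b_m vanish at p, w(a_m) vanishes by `hda`, and w(b_m)
  -- multiplies a (0,1) vector.
  rw [bracket_congr hA (Filter.Eventually.of_forall fun _ => rfl), bracket_swap,
    bracket_add_right w (cSmoothAt_comb hs ha)
      (cSmoothAt_comb (fun m => (hs m).conjField) hb),
    bracket_comb_right hs ha, bracket_comb_right (fun m => (hs m).conjField) hb, proj10_neg,
    proj10_add, proj10_add, proj10_add]
  simp only [proj10_sum_smul, ha0, hb0, hda, zero_smul, Finset.sum_const_zero]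
  have hz : ∀ l, S.proj10 p (conjField (f l) p) = 0 := fun l => S.proj10_conj_of_mem (hm l)
  simp [hz, hp0]

/-! ### First derivatives of the metric components. -/

theorem smoothFunAt_gram {k : ℕ} {f : Fin k → CField E M}
    (hf : ∀ᶠ y in 𝓝 p, ∀ i, CSmoothAt (f i) y) (i j : Fin k) :
    SmoothFunAt (E := E) (fun x => S.gram f x i j) p :=
  S.smoothFunAt_levi (hf.mono fun _ hy => hy i) (hf.mono fun _ hy => hy j)

/-- The derivative of the Gram matrix of a frame which is `1` at `p`, after a change of frame which
is `1` at `p`. -/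
theorem cder_gram_comb {k : ℕ} {f : Fin k → CField E M}
    (hf : ∀ᶠ y in 𝓝 p, ∀ i, CSmoothAt (f i) y) (h1 : S.gram f p = 1) {c : Fin k → Fin k → M → ℂ}
    (hc : ∀ i m, SmoothFunAt (E := E) (c i m) p) (hc1 : ∀ i m, c i m p = if i = m then 1 else 0)
    (i j : Fin k) (Z : Cplx (TangentSpace 𝓘(ℝ, E) p)) :
    cder (fun x => S.gram (fun i => comb f (c i)) x i j) p Z =
      cder (c i j) p Z + (starRingEnd ℂ) (cder (c j i) p Z.conj) +
        cder (fun x => S.gram f x i j) p Z := by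
  have h : (fun x => S.gram (fun i => comb f (c i)) x i j) = fun x =>
      ∑ a, ∑ b, c i a x * (starRingEnd ℂ) (c j b x) * S.gram f x a b :=
    funext fun x => S.levi_sum_smul _ _ _ _
  have hs : ∀ a b, SmoothFunAt (E := E)
      (fun x => c i a x * (starRingEnd ℂ) (c j b x) * S.gram f x a b) p := fun a b =>
    ((hc i a).mul (hc j b).conj).mul (smoothFunAt_gram hf a b)
  -- Product rule at p, where both c and the Gram matrix are the identity: each term differentiates
  -- one factor and turns the other two into Kronecker deltas.
  have hab : ∀ a b, cder (fun x => c i a x * (starRingEnd ℂ) (c j b x) * S.gram f x a b) p Z =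
      (if i = a then if j = b then cder (fun x => S.gram f x a b) p Z else 0 else 0) +
      (if a = b then (if i = a then (starRingEnd ℂ) (cder (c j b) p Z.conj) else 0) else 0) +
      (if a = b then (if j = b then cder (c i a) p Z else 0) else 0) := by
    intro a b
    rw [cder_mul Z ((hc i a).mul (hc j b).conj) (smoothFunAt_gram hf a b),
      cder_mul Z (hc i a) (hc j b).conj, cder_conj Z (hc j b), h1, hc1, hc1, Matrix.one_apply]
    split_ifs <;> simp [add_assoc]
  rw [h, cder_sum Z fun a _ => .sum fun b _ => hs a b]
  have h2 : ∀ a, cder (fun x => ∑ b, c i a x * (starRingEnd ℂ) (c j b x) * S.gram f x a b) p Z =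
      ∑ b, cder (fun x => c i a x * (starRingEnd ℂ) (c j b x) * S.gram f x a b) p Z :=
    fun a => cder_sum Z fun b _ => hs a b
  simp only [h2, hab, Finset.sum_add_distrib]
  simp
  ring

/-- A function whose derivatives along a frame of `T₁,₀` and its conjugate vanish has vanishing
horizontal differential. -/
theorem dH_eq_zero {f : Fin m₀ → CField E M}
    (hspan : Submodule.span ℂ (Set.range fun i => f i p) = S.T10 p) {g : M → ℂ}
    (h : ∀ n, cder g p (f n p) = 0) (h' : ∀ n, cder g p (f n p).conj = 0) : S.dH g p = 0 := by
  refine LinearMap.ext fun X => ?_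
  obtain ⟨W, hW, hWX⟩ := X.2
  have hW' : W ∈ S.T10 p := hW
  rw [← hspan, Submodule.mem_span_range_iff_exists_fun] at hW'
  obtain ⟨a, ha⟩ := hW'
  have h1 : cder g p W = 0 := by
    rw [← ha, map_sum]
    exact Finset.sum_eq_zero fun n _ => by rw [map_smul, h, smul_zero]
  have h2 : cder g p W.conj = 0 := by
    rw [← ha, Cplx.conj_sum, map_sum]
    exact Finset.sum_eq_zero fun n _ => by rw [Cplx.conj_smul, map_smul, h', smul_zero]
  rw [cder_apply] at h1 h2
  rw [Cplx.re_conj, Cplx.im_conj, map_neg] at h2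
  -- A horizontal vector is Re W = (W + W̄)/2 with W of type (1,0).
  have h3 : mvfderiv 𝓘(ℝ, E) g p (Cplx.re W) = 0 := by linear_combination (h1 + h2) / 2
  rw [hWX] at h3
  exact h3

end PseudoHermitianStructure

end PseudoHermitian

end

/-! ### Choice of the jets and construction of the frame. -/

open PseudoHermitian PseudoHermitianStructure

theorem proposition3p3 {m₀ : ℕ}
    {E : Type*} [NormedAddCommGroup E] [NormedSpace ℝ E] [FiniteDimensional ℝ E]
    {M : Type*} [TopologicalSpace M] [ChartedSpace E M] [IsManifold 𝓘(ℝ, E) ∞ M]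
    (S : PseudoHermitian.PseudoHermitianStructure m₀ E M) (p : M) :
    ∃ e : Fin m₀ → PseudoHermitian.CField E M,
      PseudoHermitian.IsLocalFrame S.T10 p e ∧
      (∀ i, S.IsQuasiHolomorphicAt p (e i)) ∧
      (∀ i j, S.gComp e i j p = (if i = j then 1 else 0) ∧
        MDifferentiableAt 𝓘(ℝ, E) 𝓘(ℝ, ℂ) (S.gComp e i j) p ∧
        S.dH (S.gComp e i j) p = 0) ∧
      (∀ i, S.proj10 p
        (PseudoHermitian.bracket (PseudoHermitian.ofReal S.reeb) (e i) p) = 0) := by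
  classical
  obtain ⟨f, hf, hgram⟩ := S.exists_isLocalFrame_gram_eq_one p
  have hff := isLocalFrame_iff.1 hf
  obtain ⟨hs, hli, hspan⟩ := hff.self_of_nhds
  have hm : ∀ i, f i p ∈ S.T10 p := fun i => hspan ▸ Submodule.subset_span ⟨i, rfl⟩
  have hΓ := (eventually_smoothFunAt_christoffel hf).self_of_nhds
  have hfs : ∀ᶠ y in 𝓝 p, ∀ i, CSmoothAt (f i) y := hff.mono fun _ hy => hy.1
  -- The solution of f_l g_{im̄}(p) = 0 in `cder_gram_comb`, once f̄_l c_{mi}(p) = Γ_{ml}^i(p) has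
  -- been imposed.
  let α : Fin m₀ → Fin m₀ → Fin m₀ → ℂ := fun i m l =>
    -(starRingEnd ℂ) (S.christoffel f m l i p) - cder (fun x => S.gram f x i m) p (f l p)
  -- The ξ-derivative cancels [ξ, f_i]_{1,0}, the f̄_l-derivative makes the ∂̄-coefficient vanish at
  -- p, and the second derivative is f_n(∑ c_{ik} Γ_{kl}^m)(p), which makes the f_n-derivative of
  -- that coefficient vanish.
  choose c hc hc0 hcα hcβ hcγ hcτ using fun i m => S.exists_jet hf hgram
    (if i = m then 1 else 0) (-S.coeff f p (bracket (ofReal S.reeb) (f i) p) m) (α i m)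
    (fun l => S.christoffel f i l m p)
    (fun n l => ∑ k, (α i k n * S.christoffel f k l m p +
      (if i = k then 1 else 0) * cder (S.christoffel f k l m) p (f n p)))
  have hcp : ∀ i m, SmoothFunAt (E := E) (c i m) p := fun i m => (hc i m).self_of_nhds
  have hc' : ∀ᶠ x in 𝓝 p, ∀ i m, SmoothFunAt (E := E) (c i m) x :=
    Filter.eventually_all.2 fun i => Filter.eventually_all.2 (hc i)
  have hdet : (Matrix.of fun i m => c i m p).det ≠ 0 := by
    have h : (Matrix.of fun i m => c i m p) = 1 := by
      ext i m
      rw [Matrix.of_apply, hc0, Matrix.one_apply]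
    rw [h, Matrix.det_one]
    exact one_ne_zero
  have he : IsLocalFrame S.T10 p fun i => comb f (c i) :=
    hf.change (c := fun x => Matrix.of fun i m => c i m x) hc' hdet
  have hg : ∀ i j, S.gComp (fun i => comb f (c i)) i j =ᶠ[𝓝 p]
      fun x => S.gram (fun i => comb f (c i)) x i j := by
    intro i j
    filter_upwards [isLocalFrame_iff.1 he] with x hx
    exact S.gComp_eq_levi (hx.2.2 ▸ Submodule.subset_span ⟨i, rfl⟩)
      (hx.2.2 ▸ Submodule.subset_span ⟨j, rfl⟩)
  have hgs : ∀ i j, SmoothFunAt (E := E) (fun x => S.gram (fun i => comb f (c i)) x i j) p :=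
    smoothFunAt_gram ((isLocalFrame_iff.1 he).mono fun _ hy => hy.1)
  have hgd : ∀ i j n, cder (fun x => S.gram (fun i => comb f (c i)) x i j) p (f n p) = 0 := by
    intro i j n
    rw [cder_gram_comb hfs hgram hcp hc0, hcα, hcβ]
    simp only [α]
    ring
  have hgd' : ∀ i j n,
      cder (fun x => S.gram (fun i => comb f (c i)) x i j) p (f n p).conj = 0 := by
    intro i j n
    -- Hermitian symmetry turns the f̄_n-derivative of g_{ij̄} into the conjugate of the
    -- f_n-derivative of g_{jī}.
    have h : (fun x => S.gram (fun i => comb f (c i)) x i j) =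
        fun x => (starRingEnd ℂ) (S.gram (fun i => comb f (c i)) x j i) :=
      funext fun x => (S.conj_levi _ _).symm
    rw [h, cder_conj _ (hgs j i), Cplx.conj_conj, hgd, map_zero]
  refine ⟨fun i => comb f (c i), he, fun i => ?_, fun i j => ⟨?_, ?_, ?_⟩, fun i => ?_⟩
  · refine isQuasiHolomorphicAt_comb hf (hc'.mono fun x hx => hx i) (fun l m => ?_)
      fun n l m => ?_
    · have h : cder (c i m) p (conjField (f l) p) = S.christoffel f i l m p := hcβ i m l
      simp [dbarCoeff, h, hc0]
    · have h1 : ∀ k, SmoothFunAt (E := E) (fun x => c i k x * S.christoffel f k l m x) p :=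
        fun k => (hcp i k).mul (hΓ k l m)
      have h2 := smoothFunAt_cder (hcp i m) (hs l).conjField
      have h3 : ∀ k, cder (fun x => c i k x * S.christoffel f k l m x) p (f n p) =
          α i k n * S.christoffel f k l m p +
            (if i = k then 1 else 0) * cder (S.christoffel f k l m) p (f n p) := by
        intro k
        rw [cder_mul _ (hcp i k) (hΓ k l m), hcα, hc0]
        ring
      unfold dbarCoeff
      rw [cder_sub _ (.sum fun k _ => h1 k) h2, cder_sum _ fun k _ => h1 k, hcτ]
      simp only [h3, sub_self]
  · refine (hg i j).self_of_nhds.trans ?_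
    change S.levi p (comb f (c i) p) (comb f (c j) p) = _
    have h : ∀ i, comb f (c i) p = f i p := fun i => by simp [comb, hc0]
    rw [h, h, ← gram_apply, hgram, Matrix.one_apply]
  -- `mfderiv` is zero by default where a function is not differentiable, so differentiability is
  -- what gives the vanishing of `dH` its content.
  · exact ((hgs i j).congr_of_eventuallyEq (hg i j)).mdifferentiableAt (by simp)
  · refine dH_eq_zero hspan (fun n => ?_) fun n => ?_
    · rw [cder_congr _ (hg i j), hgd]
    · rw [cder_congr _ (hg i j), hgd']
  -- At p the bracket is [ξ, f_i] + ∑ ξ(c_{im}) f_m, and the chosen ξ-derivatives cancel its (1,0)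
  -- part.
  · rw [bracket_comb_right hs (hcp i), proj10_add, proj10_sum_smul, proj10_sum_smul]
    have h : ∀ m, cder (c i m) p (ofReal S.reeb p) =
        -S.coeff f p (bracket (ofReal S.reeb) (f i) p) m := fun m => hcγ i m
    simp only [S.proj10_of_mem (hm _), h, hc0, ite_smul, one_smul, zero_smul]
    rw [Finset.sum_ite_eq, if_pos (Finset.mem_univ _), S.proj10_eq_sum_coeff hli hspan,
      ← Finset.sum_add_distrib]
    exact Finset.sum_eq_zero fun m _ => by rw [neg_smul, add_neg_cancel]
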